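/- Notation. Let $\gamma_1>\gamma_2$ and $\alpha$ be real, $\beta_1=(\gamma_1+\gamma_2)/2$, $\beta_2=(\gamma_1-\gamma_2)/2$, and $(T_\pm u)(x)=u(x\mp\alpha)$ on $L^2(\mathbb R)$. In $L^2(\mathbb R;\mathbb C^2)$ let $$A=\tfrac12(D_x^2+x^2)\,I_2\quad (D_x=-i\,d/dx),\qquad B=\begin{bmatrix}\beta_1&\beta_2T_+^2\\ \beta_2T_-^2&\beta_1\end{bmatrix},$$ where $A$ has its maximal domain $\{u\in L^2:\ Au\in L^2\}$ ($Au$ in the sense of distributions) and $D(A+\varepsilon B)=D(A)$. (For $\alpha\neq 0$, $A+\varepsilon B$ is unitarily equivalent to the shifted Rabi system $\tfrac12(D_x^2+x^2)I_2+\alpha x\begin{bmatrix}0&1\\1&0\end{bmatrix}+\varepsilon\begin{bmatrix}\gamma_1&0\\0&\gamma_2\end{bmatrix}+\tfrac{\alpha^2}{2}I_2$.) For $N=0,1,2,\dots$ let $\varphi_N=\bigl((x-\partial_x)/\sqrt2\bigr)^Ne^{-x^2/2}$, let $(\cdot,\cdot)_0$ and $\|\cdot\|_0$ be the $L^2$ inner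 product and norm, and put $$\mu_\pm=\mu_\pm^{(N)}=\beta_1\pm\beta_2\frac{|(T_+\varphi_N,T_-\varphi_N)_0|}{\|\varphi_N\|_0^2},\qquad \boldsymbol\phi_\pm=\boldsymbol\phi_\pm^{(N)}=\frac{\varphi_N}{\|\varphi_N\|_0}\otimes\frac1{\sqrt2}\begin{bmatrix}\operatorname{sgn}(T_+\varphi_N,T_-\varphi_N)_0\\ \pm1\end{bmatrix}.$$ Let $L_n(Z)=\sum_{j=0}^n(-1)^j\binom nj\frac{Z^j}{j!}$ be the Laguerre polynomials and $\mathsf Z\subset[0,\infty)$ the set of all their zeros. Theorem. Let $x_0=2\alpha^2\in(0,\infty)\setminus\mathsf Z$. There exist sequences $(k_j)_j$ of natural numbers and $(\delta_j)_j$ of positive reals with $k_j\nearrow+\infty$ and $\delta_j\searrow0$ such that for every $j$ and every $n\le k_j$ all real roots of $L_n$ are at distance at least $\delta_j$ from $x_0$. For any such sequences and every $j$ there is $c_j\in(0,1)$ such that for all $N\le k_j$ the following holds. The eigenspace of $A$ for the eigenvalue $N+1/2$ has dimension $2$, $\mu_-<\mu_+$, and there are real-analytic functions $\lambda_\pm^{(N)}:(-c_j,c_j)\to\mathbb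 R$ and $u_\pm^{(N)}:(-c_j,c_j)\to L^2(\mathbb R;\mathbb C^2)$, with $\lambda_-^{(N)}(\varepsilon)\ne\lambda_+^{(N)}(\varepsilon)$ for $0<|\varepsilon|<c_j$, such that for all $|\varepsilon|<c_j$ $$\lambda_\pm^{(N)}(\varepsilon)=\sum_{k\ge0}\lambda_{k,\pm}^{(N)}\varepsilon^k,\qquad \lambda_{0,\pm}^{(N)}=N+\tfrac12,\qquad \lambda_{1,\pm}^{(N)}=\mu_\pm,$$ $$u_\pm^{(N)}(\varepsilon)=\sum_{k\ge0}u_{k,\pm}^{(N)}\varepsilon^k\ \text{ (convergence in } L^2),\qquad u_{0,\pm}^{(N)}=\boldsymbol\phi_\pm,\qquad u_{k,\pm}^{(N)}\in\mathscr S(\mathbb R;\mathbb C^2)\ \text{ for all } k,$$ $$\|u_\pm^{(N)}(\varepsilon)\|_0=1,\qquad (u_{0,\pm}^{(N)},u_{k,\pm}^{(N)})_0\in\mathbb R\ \text{ for all } k\ge1,$$ $$u_\pm^{(N)}(\varepsilon)\in D(A+\varepsilon B),\qquad (A+\varepsilon B)\,u_\pm^{(N)}(\varepsilon)=\lambda_\pm^{(N)}(\varepsilon)\,u_\pm^{(N)}(\varepsilon).$$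 -/

import Mathlib

open MeasureTheory Filter Topology
open scoped SchwartzMap

noncomputable section

namespace Rabi

/-! ### Laguerre polynomials and their zeros -/

/-- The `n`-th Laguerre polynomial `L_n(Z) = ∑_{j ≤ n} (-1)^j (n choose j) Z^j / j!`. -/
def laguerre (n : ℕ) : Polynomial ℝ :=
  ∑ j ∈ Finset.range (n + 1),
    Polynomial.C ((-1 : ℝ) ^ j * (n.choose j : ℝ) / (j.factorial : ℝ)) * Polynomial.X ^ j

/-- The set of all zeros in `[0, ∞)` of all Laguerre polynomials. -/
def laguerreZeros : Set ℝ := {x | 0 ≤ x ∧ ∃ n : ℕ, (laguerre n).eval x = 0}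

/-- `(k_j)` is a sequence of naturals increasing to `∞` and `(δ_j)` a sequence of positive reals
decreasing to `0` such that, for every `j` and every `n ≤ k_j`, all roots of `L_n` are at distance
at least `δ_j` from `x₀`. (The sequences are indexed by `j = 0, 1, 2, …`.) -/
structure IsRootGapSequence (x₀ : ℝ) (k : ℕ → ℕ) (δ : ℕ → ℝ) : Prop where
  monotone_k : Monotone k
  tendsto_k : Tendsto k atTop atTop
  pos_δ : ∀ j, 0 < δ j
  antitone_δ : Antitone δ
  tendsto_δ : Tendsto δ atTop (𝓝 0)
  gap : ∀ j, ∀ n ≤ k j, ∀ x : ℝ, (laguerre n).eval x = 0 → δ j ≤ |x - x₀|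

/-! ### Hermite functions -/

/-- The Hermite functions `φ_N = ((x - ∂_x) / √2)^N e^{-x²/2}`. -/
def phi : ℕ → ℝ → ℝ
  | 0 => fun x => Real.exp (-x ^ 2 / 2)
  | n + 1 => fun x => (x * phi n x - deriv (phi n) x) / √2

/-- `‖φ_N‖₀²`. -/
def phiNormSq (N : ℕ) : ℝ := ∫ x, phi N x ^ 2

/-- `(T₊ φ_N, T₋ φ_N)₀`, where `(T_± u)(x) = u(x ∓ α)`; everything is real valued. -/
def overlap (α : ℝ) (N : ℕ) : ℝ := ∫ x, phi N (x - α) * phi N (x + α)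

/-- `β₁ = (γ₁ + γ₂) / 2`. -/
def beta₁ (γ₁ γ₂ : ℝ) : ℝ := (γ₁ + γ₂) / 2

/-- `β₂ = (γ₁ - γ₂) / 2`. -/
def beta₂ (γ₁ γ₂ : ℝ) : ℝ := (γ₁ - γ₂) / 2

/-- `μ_± = β₁ ± β₂ |(T₊ φ_N, T₋ φ_N)₀| / ‖φ_N‖₀²`; the sign is the unit `s = 1` or `s = -1`
of `ℤ`. -/
def mu (α γ₁ γ₂ : ℝ) (N : ℕ) (s : ℤˣ) : ℝ :=
  beta₁ γ₁ γ₂ + ((s : ℤ) : ℝ) * (beta₂ γ₁ γ₂ * |overlap α N| / phiNormSq N)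

/-! ### The Hilbert space and the operators -/

/-- `ℂ²` with its Hermitian norm. -/
abbrev C2 : Type := EuclideanSpace ℂ (Fin 2)

/-- `L²(ℝ; ℂ²)`. -/
abbrev L2C2 : Type := Lp C2 2 (volume : Measure ℝ)

/-- `φ_± = φ_N ⊗ w_± / ‖φ_N‖₀` with `w_± = (sgn (T₊ φ_N, T₋ φ_N)₀, ±1) / √2`. -/
def phiPM (α : ℝ) (N : ℕ) (s : ℤˣ) (x : ℝ) : C2 :=
  ((phi N x / √(phiNormSq N) : ℝ) : ℂ) •
    !₂[((Real.sign (overlap α N) / √2 : ℝ) : ℂ), ((((s : ℤ) : ℝ) / √2 : ℝ) : ℂ)]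

/-- Translation `u ↦ u(· - a)` as a linear isometry of `L²(ℝ)`. Thus `T_± = translation (±α)`. -/
def translation (a : ℝ) : Lp ℂ 2 (volume : Measure ℝ) →ₗᵢ[ℂ] Lp ℂ 2 (volume : Measure ℝ) :=
  Lp.compMeasurePreservingₗᵢ ℂ (fun x : ℝ => x - a) (measurePreserving_sub_right volume a)

/-- The `i`-th component `L²(ℝ; ℂ²) → L²(ℝ)`. -/
def component (i : Fin 2) : L2C2 →L[ℂ] Lp ℂ 2 (volume : Measure ℝ) :=
  (EuclideanSpace.proj i : C2 →L[ℂ] ℂ).compLpL 2 volume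

/-- The embedding `v ↦ v ⊗ e_i` of `L²(ℝ)` into `L²(ℝ; ℂ²)`. -/
def embed (i : Fin 2) : Lp ℂ 2 (volume : Measure ℝ) →L[ℂ] L2C2 :=
  (ContinuousLinearMap.toSpanSingleton ℂ (EuclideanSpace.single i (1 : ℂ) : C2)).compLpL 2 volume

/-- The bounded operator with matrix `[[β₁, β₂ T₊²], [β₂ T₋², β₁]]` on `L²(ℝ; ℂ²)`. -/
def opB (α γ₁ γ₂ : ℝ) : L2C2 →L[ℂ] L2C2 :=
  let Tp := (translation α).toContinuousLinearMap
  let Tm := (translation (-α)).toContinuousLinearMap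
  (beta₁ γ₁ γ₂ : ℂ) • ContinuousLinearMap.id ℂ L2C2 +
    (beta₂ γ₁ γ₂ : ℂ) •
      (embed 0 ∘L (Tp ∘L Tp) ∘L component 1 + embed 1 ∘L (Tm ∘L Tm) ∘L component 0)

theorem opB_ae (α γ₁ γ₂ : ℝ) (u : L2C2) :
    opB α γ₁ γ₂ u =ᵐ[volume] fun x =>
      !₂[(beta₁ γ₁ γ₂ : ℂ) * u x 0 + (beta₂ γ₁ γ₂ : ℂ) * u (x - α - α) 1,
        (beta₂ γ₁ γ₂ : ℂ) * u (x + α + α) 0 + (beta₁ γ₁ γ₂ : ℂ) * u x 1] := by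
  have hT : ∀ (a : ℝ) (v : Lp ℂ 2 (volume : Measure ℝ)),
      translation a v =ᵐ[volume] fun x => v (x - a) := fun a v =>
    Lp.coeFn_compMeasurePreserving v (measurePreserving_sub_right volume a)
  have hTT : ∀ (a : ℝ) (v : Lp ℂ 2 (volume : Measure ℝ)),
      translation a (translation a v) =ᵐ[volume] fun x => v (x - a - a) := fun a v =>
    (hT a _).trans
      ((measurePreserving_sub_right volume a).quasiMeasurePreserving.ae_eq_comp (hT a v))
  have hc : ∀ i : Fin 2, component i u =ᵐ[volume] fun x => u x i := fun i =>
    ContinuousLinearMap.coeFn_compLpL _ u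
  have hTc : ∀ (a : ℝ) (i : Fin 2),
      translation a (translation a (component i u)) =ᵐ[volume] fun x => u (x - a - a) i := by
    intro a i
    refine (hTT a _).trans ?_
    exact ((measurePreserving_sub_right volume a).comp
      (measurePreserving_sub_right volume a)).quasiMeasurePreserving.ae_eq_comp (hc i)
  have he : ∀ (i : Fin 2) (v : Lp ℂ 2 (volume : Measure ℝ)),
      embed i v =ᵐ[volume] fun x => v x • EuclideanSpace.single i (1 : ℂ) := fun i v =>
    ContinuousLinearMap.coeFn_compLpL _ v
  set v₀ := translation α (translation α (component 1 u)) with hv₀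
  set v₁ := translation (-α) (translation (-α) (component 0 u)) with hv₁
  have hB : opB α γ₁ γ₂ u =
      (beta₁ γ₁ γ₂ : ℂ) • u + (beta₂ γ₁ γ₂ : ℂ) • (embed 0 v₀ + embed 1 v₁) := rfl
  rw [hB]
  filter_upwards [Lp.coeFn_add ((beta₁ γ₁ γ₂ : ℂ) • u)
      ((beta₂ γ₁ γ₂ : ℂ) • (embed 0 v₀ + embed 1 v₁)),
    Lp.coeFn_smul (beta₁ γ₁ γ₂ : ℂ) u,
    Lp.coeFn_smul (beta₂ γ₁ γ₂ : ℂ) (embed 0 v₀ + embed 1 v₁),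
    Lp.coeFn_add (embed 0 v₀) (embed 1 v₁), he 0 v₀, he 1 v₁, hTc α 1, hTc (-α) 0]
    with x h1 h2 h3 h4 h5 h6 h7 h8
  rw [h1, Pi.add_apply, h2, h3, Pi.smul_apply, Pi.smul_apply, h4, Pi.add_apply, h5, h6, hv₀, hv₁,
    h7, h8]
  ext i
  fin_cases i <;> simp [add_comm]

/-- The harmonic oscillator `(D_x² + x²) / 2` (times the identity matrix) on Schwartz functions. -/
def oscSchwartz : 𝓢(ℝ, C2) →L[ℝ] 𝓢(ℝ, C2) :=
  (1 / 2 : ℝ) • (SchwartzMap.smulLeftCLM C2 (fun x : ℝ => x ^ 2) -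
    SchwartzMap.derivCLM ℝ C2 ∘L SchwartzMap.derivCLM ℝ C2)

theorem oscSchwartz_apply (ψ : 𝓢(ℝ, C2)) (x : ℝ) :
    oscSchwartz ψ x = (1 / 2 : ℝ) • (x ^ 2 • ψ x - deriv (deriv ψ) x) := by
  have hx : Function.HasTemperateGrowth (fun x : ℝ => x ^ 2) := by fun_prop
  have hd : SchwartzMap.derivCLM ℝ C2 (SchwartzMap.derivCLM ℝ C2 ψ) x = deriv (deriv ψ) x := by
    rw [SchwartzMap.derivCLM_apply]
    congr 1
  change (1 / 2 : ℝ) • (SchwartzMap.smulLeftCLM C2 (fun x : ℝ => x ^ 2) ψ x -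
    SchwartzMap.derivCLM ℝ C2 (SchwartzMap.derivCLM ℝ C2 ψ) x) = _
  rw [SchwartzMap.smulLeftCLM_apply_apply hx, hd]

/-- The pairs `(f, g)` in `L² × L²` such that `(D_x² + x²) f / 2 = g` in the sense of
distributions. -/
def oscGraph : Submodule ℂ (L2C2 × L2C2) where
  carrier := {p | ∀ ψ : 𝓢(ℝ, C2),
    inner ℂ (ψ.toLp 2) p.2 = inner ℂ ((oscSchwartz ψ).toLp 2) p.1}
  add_mem' := by
    intro p q hp hq ψ
    simp only [Prod.fst_add, Prod.snd_add, inner_add_right, hp ψ, hq ψ]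
  zero_mem' := by
    intro ψ
    simp
  smul_mem' := by
    intro c p hp ψ
    simp only [Prod.smul_fst, Prod.smul_snd, inner_smul_right, hp ψ]

theorem oscGraph_functional (p : L2C2 × L2C2) (hp : p ∈ oscGraph) (h : p.1 = 0) : p.2 = 0 := by
  have hd : DenseRange (SchwartzMap.toLpCLM ℝ C2 2 (volume : Measure ℝ)) :=
    SchwartzMap.denseRange_toLpCLM (by norm_num)
  refine hd.eq_zero_of_inner_right ℂ fun ψ => ?_
  have := hp ψ
  rwa [h, inner_zero_right] at this

/-- `A = ((D_x² + x²) / 2) I₂` with its maximal domain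
`{u ∈ L²(ℝ; ℂ²) | (D_x² + x²) u / 2 ∈ L²(ℝ; ℂ²)}`, as an unbounded operator. -/
def opA : L2C2 →ₗ.[ℂ] L2C2 := oscGraph.toLinearPMap

theorem opA_graph : opA.graph = oscGraph :=
  oscGraph.toLinearPMap_graph_eq oscGraph_functional

/-- `A + ε B`, with domain `D(A + ε B) = D(A)`. -/
def opAB (α γ₁ γ₂ ε : ℝ) : L2C2 →ₗ.[ℂ] L2C2 where
  domain := opA.domain
  toFun := opA.toFun + (ε : ℂ) • ((opB α γ₁ γ₂ : L2C2 →ₗ[ℂ] L2C2) ∘ₗ opA.domain.subtype)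

/-- The eigenspace `Ker (T - z)` of an unbounded operator, as a subspace of `L²(ℝ; ℂ²)`. -/
def eigenspace (T : L2C2 →ₗ.[ℂ] L2C2) (z : ℂ) : Submodule ℂ L2C2 :=
  (LinearMap.ker (T.toFun - z • T.domain.subtype)).map T.domain.subtype

/-- `u` belongs to the domain of `T` and `T u = z u`. -/
def IsEigenEq (T : L2C2 →ₗ.[ℂ] L2C2) (z : ℂ) (u : L2C2) : Prop :=
  ∃ h : u ∈ T.domain, T ⟨u, h⟩ = z • u

end Rabi

end

noncomputable section

namespace Rabi

/-! The eigenvalue `N + 1/2` of `A` is double, but a symmetry splits it. The involution `(u₁, u₂) ↦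
(u₂(-·), u₁(-·))` commutes with `A` and with `B`, and its eigenspaces consist of the pairs `(f, κ
f(-·))` with `κ = ±1`. On such a sector `A` acts as the scalar oscillator, whose spectrum is simple,
and `B` acts as the bounded operator `f ↦ β₁ f + β₂ κ f(2α - ·)` (`opB_sectorL`). Nondegenerate
Rayleigh–Schrödinger theory therefore applies in each sector. Real `f` suffice, so the phase
condition on the coefficients holds automatically.

In a sector the perturbed vector solves `U = h + S(μ U - ε C U)`, where `h` is the normalised
Hermite function, `S` the reduced resolvent, `C` the reduced perturbation and `μ = ε ⟨h, C U⟩`. The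
coefficients of its power series are dominated by Catalan numbers, so the series converges, and
division by `‖U‖` keeps it analytic (`exists_perturbed_eigenvector`). They are Schwartz functions
because `C` and `S` preserve rapid decrease of Hermite coefficients, which characterises Schwartz
functions (`mem_schwartzL2_iff_rapidDecay`). Completeness of the Hermite functions is proved by the
moment argument.

By parity the first-order coefficient `⟨h, C h⟩` equals `β₁ + β₂ κ (-1)^N o / ‖φ_N‖²` with `o` the
overlap. The choice `κ = sgn(o) s (-1)^N` makes it `μ_s`. The ladder operators give `o` as `N!
L_N(2α²)` times a positive Gaussian integral (`inner_phiS_shiftS_phiS`). Hence `o ≠ 0` off the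
Laguerre zeros, the numbers `μ_±` differ, and the two branches separate for small `ε ≠ 0`. A minimum
over the finitely many `N ≤ k_j` gives a common `c_j`. -/

/-! ### The real Hilbert space, ladder operators on Schwartz functions -/

/-- The real Hilbert space `L²(ℝ)`. -/
abbrev L2R : Type := Lp ℝ 2 (volume : Measure ℝ)

/-- The inclusion of real Schwartz functions into `L²`. -/
def toL2 : 𝓢(ℝ, ℝ) →L[ℝ] L2R := SchwartzMap.toLpCLM ℝ ℝ 2 volume

theorem toL2_ae (f : 𝓢(ℝ, ℝ)) : toL2 f =ᵐ[volume] f := f.coeFn_toLp 2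

theorem toL2_injective : Function.Injective toL2 := SchwartzMap.injective_toLp 2 volume

theorem inner_toL2 (f g : 𝓢(ℝ, ℝ)) : inner ℝ (toL2 f) (toL2 g) = ∫ x, f x * g x := by
  rw [L2.inner_def]
  refine integral_congr_ae ?_
  filter_upwards [toL2_ae f, toL2_ae g] with x hf hg
  rw [hf, hg]
  simp [mul_comm]

theorem inner_toL2_right (f : L2R) (g : 𝓢(ℝ, ℝ)) : inner ℝ (toL2 g) f = ∫ x, g x * f x := by
  rw [L2.inner_def]
  refine integral_congr_ae ?_
  filter_upwards [toL2_ae g] with x hg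
  rw [hg]
  simp [mul_comm]

/-- Multiplication by the coordinate. -/
def mulX : 𝓢(ℝ, ℝ) →L[ℝ] 𝓢(ℝ, ℝ) := SchwartzMap.smulLeftCLM ℝ (fun x : ℝ => x)

/-- Differentiation. -/
def diffS : 𝓢(ℝ, ℝ) →L[ℝ] 𝓢(ℝ, ℝ) := SchwartzMap.derivCLM ℝ ℝ

theorem mulX_apply (f : 𝓢(ℝ, ℝ)) (x : ℝ) : mulX f x = x * f x :=
  SchwartzMap.smulLeftCLM_apply_apply (by fun_prop) f x

theorem diffS_apply (f : 𝓢(ℝ, ℝ)) (x : ℝ) : diffS f x = deriv f x :=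
  SchwartzMap.derivCLM_apply ℝ f x

theorem diffS_mulX (f : 𝓢(ℝ, ℝ)) : diffS (mulX f) = mulX (diffS f) + f := by
  ext x
  have h : (mulX f : ℝ → ℝ) = fun x => x * f x := funext (mulX_apply f)
  rw [diffS_apply, h, add_apply, mulX_apply, diffS_apply]
  have := ((hasDerivAt_id x).mul (f.hasDerivAt x)).deriv
  simp only [id] at this
  refine Eq.trans this ?_
  ring

theorem inner_mulX (f g : 𝓢(ℝ, ℝ)) :
    inner ℝ (toL2 (mulX f)) (toL2 g) = inner ℝ (toL2 f) (toL2 (mulX g)) := by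
  simp only [inner_toL2, mulX_apply]
  congr 1; ext x; ring

theorem inner_diffS (f g : 𝓢(ℝ, ℝ)) :
    inner ℝ (toL2 (diffS f)) (toL2 g) = -inner ℝ (toL2 f) (toL2 (diffS g)) := by
  simp only [inner_toL2, diffS_apply]
  rw [SchwartzMap.integral_mul_deriv_eq_neg_deriv_mul, neg_neg]

/-- The annihilation operator `(x + ∂_x) / √2`. -/
def lower : 𝓢(ℝ, ℝ) →L[ℝ] 𝓢(ℝ, ℝ) := (√2)⁻¹ • (mulX + diffS)

/-- The creation operator `(x - ∂_x) / √2`. -/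
def raise : 𝓢(ℝ, ℝ) →L[ℝ] 𝓢(ℝ, ℝ) := (√2)⁻¹ • (mulX - diffS)

theorem lower_apply (f : 𝓢(ℝ, ℝ)) : lower f = (√2)⁻¹ • (mulX f + diffS f) := rfl

theorem raise_apply (f : 𝓢(ℝ, ℝ)) : raise f = (√2)⁻¹ • (mulX f - diffS f) := rfl

theorem inv_sqrt_two_mul_self : (√2 : ℝ)⁻¹ * (√2)⁻¹ = 1 / 2 := by
  rw [← mul_inv, Real.mul_self_sqrt (by norm_num)]; norm_num

theorem mulX_eq (f : 𝓢(ℝ, ℝ)) : mulX f = (√2)⁻¹ • (lower f + raise f) := by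
  rw [lower_apply, raise_apply, ← smul_add, smul_smul, inv_sqrt_two_mul_self,
    add_add_sub_cancel, ← two_smul ℝ (mulX f), smul_smul]
  norm_num

theorem diffS_eq (f : 𝓢(ℝ, ℝ)) : diffS f = (√2)⁻¹ • (lower f - raise f) := by
  rw [lower_apply, raise_apply, ← smul_sub, smul_smul, inv_sqrt_two_mul_self,
    add_sub_sub_cancel, ← two_smul ℝ (diffS f), smul_smul]
  norm_num

theorem lower_raise (f : 𝓢(ℝ, ℝ)) : lower (raise f) = raise (lower f) + f := by
  simp only [lower_apply, raise_apply, map_smul, map_add, map_sub, diffS_mulX, ← smul_add,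
    ← smul_sub, smul_smul, inv_sqrt_two_mul_self]
  ext x
  simp only [add_apply, sub_apply, smul_apply, smul_eq_mul]
  ring

theorem inner_raise (f g : 𝓢(ℝ, ℝ)) :
    inner ℝ (toL2 (raise f)) (toL2 g) = inner ℝ (toL2 f) (toL2 (lower g)) := by
  simp only [lower_apply, raise_apply, map_smul, map_add, map_sub, inner_smul_left,
    inner_smul_right, inner_add_right, inner_sub_left, inner_mulX, inner_diffS]
  simp

theorem inner_lower (f g : 𝓢(ℝ, ℝ)) :
    inner ℝ (toL2 (lower f)) (toL2 g) = inner ℝ (toL2 f) (toL2 (raise g)) := by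
  rw [real_inner_comm, ← inner_raise, real_inner_comm]

/-- The scalar oscillator `(D_x² + x²) / 2` on Schwartz functions. -/
def osc : 𝓢(ℝ, ℝ) →L[ℝ] 𝓢(ℝ, ℝ) :=
  (1 / 2 : ℝ) • (mulX ∘L mulX - diffS ∘L diffS)

theorem osc_apply (f : 𝓢(ℝ, ℝ)) :
    osc f = (1 / 2 : ℝ) • (mulX (mulX f) - diffS (diffS f)) := rfl

/-- The factorisation through the number operator: with the commutation relation `lower_raise` it
yields the eigenvalues and the symmetry of the oscillator algebraically. -/
theorem osc_eq (f : 𝓢(ℝ, ℝ)) : osc f = raise (lower f) + (1 / 2 : ℝ) • f := by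
  simp only [osc_apply, lower_apply, raise_apply, map_smul, map_add, diffS_mulX]
  ext x
  simp only [add_apply, sub_apply, smul_apply, smul_eq_mul]
  linear_combination
    ((diffS (diffS f)) x + f x - (mulX (mulX f)) x) * inv_sqrt_two_mul_self

theorem inner_osc (f g : 𝓢(ℝ, ℝ)) :
    inner ℝ (toL2 (osc f)) (toL2 g) = inner ℝ (toL2 f) (toL2 (osc g)) := by
  simp only [osc_eq, map_add, map_smul, inner_add_left, inner_add_right, inner_raise,
    inner_smul_left, inner_smul_right, ← inner_lower]
  simp

/-! ### Hermite functions as Schwartz functions -/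

/-- One term of the exponential series gives `|x|^m ≤ m! e^{|x|}`, and `|x| - x²/2 ≤ 1/2` because
`(|x| - 1)² ≥ 0`. -/
theorem abs_pow_mul_gaussian_le (m : ℕ) (x : ℝ) :
    |x| ^ m * Real.exp (-(x ^ 2 / 2)) ≤ m.factorial * Real.exp (1 / 2) := by
  have h1 : |x| ^ m ≤ m.factorial * Real.exp |x| := by
    have := Real.pow_div_factorial_le_exp |x| (abs_nonneg x) m
    rwa [div_le_iff₀' (by positivity)] at this
  calc |x| ^ m * Real.exp (-(x ^ 2 / 2))
      ≤ m.factorial * Real.exp |x| * Real.exp (-(x ^ 2 / 2)) := by gcongr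
    _ = m.factorial * Real.exp (|x| + -(x ^ 2 / 2)) := by rw [mul_assoc, Real.exp_add]
    _ ≤ _ := by
      gcongr
      nlinarith [sq_nonneg (|x| - 1), sq_abs x]

theorem exists_bound_polynomial_mul_gaussian (p : Polynomial ℝ) :
    ∃ C, ∀ x : ℝ, |p.eval x| * Real.exp (-(x ^ 2 / 2)) ≤ C := by
  induction p using Polynomial.induction_on' with
  | add p q hp hq =>
    obtain ⟨C, hC⟩ := hp
    obtain ⟨C', hC'⟩ := hq
    refine ⟨C + C', fun x => ?_⟩
    rw [Polynomial.eval_add]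
    calc _ ≤ (|p.eval x| + |q.eval x|) * Real.exp (-(x ^ 2 / 2)) := by
          gcongr; exact abs_add_le _ _
      _ ≤ _ := by rw [add_mul]; exact add_le_add (hC x) (hC' x)
  | monomial n a =>
    refine ⟨|a| * (n.factorial * Real.exp (1 / 2)), fun x => ?_⟩
    rw [Polynomial.eval_monomial, abs_mul, abs_pow, mul_assoc]
    exact mul_le_mul_of_nonneg_left (abs_pow_mul_gaussian_le n x) (abs_nonneg a)

/-- The Gaussian `e^{-x²/2}` as a Schwartz function. -/
def gaussian : 𝓢(ℝ, ℝ) where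
  toFun x := Real.exp (-x ^ 2 / 2)
  smooth' := by fun_prop
  decay' k n := by
    -- The `n`-th derivative of the Gaussian is, up to sign, the `n`-th Hermite polynomial times the
    -- Gaussian.
    obtain ⟨C, hC⟩ := exists_bound_polynomial_mul_gaussian
      (Polynomial.X ^ k * (Polynomial.hermite n).map (Int.castRingHom ℝ))
    refine ⟨C, fun x => ?_⟩
    have he : (fun x : ℝ => Real.exp (-x ^ 2 / 2)) = fun x => Real.exp (-(x ^ 2 / 2)) := by
      ext x; rw [neg_div]
    rw [norm_iteratedFDeriv_eq_norm_iteratedDeriv, iteratedDeriv_eq_iterate, he,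
      Polynomial.deriv_gaussian_eq_hermite_mul_gaussian]
    refine le_trans (le_of_eq ?_) (hC x)
    rw [Polynomial.eval_mul, Polynomial.eval_pow, Polynomial.eval_X, Polynomial.eval_map,
      Polynomial.aeval_def]
    simp [abs_mul, mul_assoc]

theorem gaussian_apply (x : ℝ) : gaussian x = Real.exp (-x ^ 2 / 2) := rfl

/-- The Hermite function `φ_N` as a Schwartz function. -/
def phiS : ℕ → 𝓢(ℝ, ℝ)
  | 0 => gaussian
  | n + 1 => raise (phiS n)

theorem phiS_zero : phiS 0 = gaussian := rfl

theorem phiS_succ (n : ℕ) : phiS (n + 1) = raise (phiS n) := rfl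

theorem coe_phiS (n : ℕ) : (phiS n : ℝ → ℝ) = phi n := by
  induction n with
  | zero => rfl
  | succ n ih =>
    ext x
    rw [phiS_succ, raise_apply, smul_apply, sub_apply, mulX_apply,
      diffS_apply, ih, phi, smul_eq_mul, ← div_eq_inv_mul]

theorem deriv_gaussian (x : ℝ) : deriv gaussian x = -x * gaussian x := by
  have h : HasDerivAt (fun x : ℝ => Real.exp (-x ^ 2 / 2)) (Real.exp (-x ^ 2 / 2) * (-x)) x := by
    have : HasDerivAt (fun x : ℝ => -x ^ 2 / 2) (-x) x := by
      have := ((hasDerivAt_pow 2 x).neg).div_const 2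
      convert! this using 1
      simp; ring
    exact this.exp
  rw [gaussian_apply, mul_comm]
  exact h.deriv

theorem lower_phiS_zero : lower (phiS 0) = 0 := by
  ext x
  rw [phiS_zero, lower_apply, smul_apply, add_apply, mulX_apply,
    diffS_apply, deriv_gaussian]
  simp

theorem raise_lower_phiS (n : ℕ) : raise (lower (phiS n)) = (n : ℝ) • phiS n := by
  induction n with
  | zero => rw [lower_phiS_zero, map_zero]; simp
  | succ n ih =>
    rw [phiS_succ, lower_raise, ih, map_add, map_smul, Nat.cast_succ, add_smul, one_smul]

theorem lower_phiS_succ (n : ℕ) : lower (phiS (n + 1)) = ((n : ℝ) + 1) • phiS n := by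
  rw [phiS_succ, lower_raise, raise_lower_phiS, add_smul, one_smul]

theorem osc_phiS (n : ℕ) : osc (phiS n) = ((n : ℝ) + 1 / 2) • phiS n := by
  rw [osc_eq, raise_lower_phiS, add_smul]

/-- These are eigenvectors of a symmetric operator for distinct eigenvalues. -/
theorem inner_phiS_of_ne {m n : ℕ} (h : m ≠ n) :
    inner ℝ (toL2 (phiS m)) (toL2 (phiS n)) = 0 := by
  have := inner_osc (phiS m) (phiS n)
  rw [osc_phiS, osc_phiS, map_smul, map_smul, inner_smul_left, inner_smul_right] at this
  have h2 : ((m : ℝ) - n) * inner ℝ (toL2 (phiS m)) (toL2 (phiS n)) = 0 := by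
    simp only [conj_trivial] at this
    linarith
  exact (mul_eq_zero.1 h2).resolve_left (sub_ne_zero.2 (by exact_mod_cast h))

theorem phiNormSq_eq (n : ℕ) : phiNormSq n = inner ℝ (toL2 (phiS n)) (toL2 (phiS n)) := by
  rw [inner_toL2, phiNormSq, coe_phiS]
  simp [sq]

theorem phiNormSq_succ (n : ℕ) : phiNormSq (n + 1) = (n + 1) * phiNormSq n := by
  rw [phiNormSq_eq, phiNormSq_eq, phiS_succ, inner_raise, ← phiS_succ, lower_phiS_succ, map_smul,
    inner_smul_right]

theorem phiNormSq_pos (n : ℕ) : 0 < phiNormSq n := by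
  induction n with
  | zero =>
    rw [phiNormSq_eq, real_inner_self_eq_norm_sq]
    refine pow_pos (norm_pos_iff.2 fun h => ?_) 2
    rw [← map_zero toL2] at h
    have := congrArg (fun f : 𝓢(ℝ, ℝ) => f 0) (toL2_injective h)
    simp [phiS_zero, gaussian_apply] at this
  | succ n ih => rw [phiNormSq_succ]; positivity

/-- The `L²`-normalised Hermite functions. -/
def hermS (n : ℕ) : 𝓢(ℝ, ℝ) := (√(phiNormSq n))⁻¹ • phiS n

theorem hermS_apply (n : ℕ) (x : ℝ) : hermS n x = phi n x / √(phiNormSq n) := by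
  rw [hermS, smul_apply, coe_phiS, smul_eq_mul, div_eq_inv_mul]

theorem orthonormal_hermS : Orthonormal ℝ fun n => toL2 (hermS n) := by
  rw [orthonormal_iff_ite]
  intro m n
  rw [hermS, hermS, map_smul, map_smul, inner_smul_left, inner_smul_right]
  split_ifs with h
  · subst h
    have := phiNormSq_pos m
    rw [← phiNormSq_eq, conj_trivial, ← mul_assoc, ← mul_inv, Real.mul_self_sqrt this.le,
      inv_mul_cancel₀ this.ne']
  · rw [inner_phiS_of_ne h]; simp

theorem osc_hermS (n : ℕ) : osc (hermS n) = ((n : ℝ) + 1 / 2) • hermS n := by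
  rw [hermS, map_smul, osc_phiS, smul_comm]

theorem raise_hermS (n : ℕ) : raise (hermS n) = √((n : ℝ) + 1) • hermS (n + 1) := by
  have h := phiNormSq_pos n
  rw [hermS, hermS, map_smul, ← phiS_succ, phiNormSq_succ, smul_smul,
    Real.sqrt_mul (by positivity), mul_inv, ← mul_assoc, mul_inv_cancel₀ (by positivity), one_mul]

theorem lower_hermS_succ (n : ℕ) : lower (hermS (n + 1)) = √((n : ℝ) + 1) • hermS n := by
  have h := phiNormSq_pos n
  rw [hermS, hermS, map_smul, lower_phiS_succ, phiNormSq_succ, smul_smul, smul_smul,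
    Real.sqrt_mul (by positivity)]
  congr 1
  have h2 : √((n : ℝ) + 1) * √((n : ℝ) + 1) = n + 1 := Real.mul_self_sqrt (by positivity)
  have h3 : (0 : ℝ) < √((n : ℝ) + 1) := by positivity
  have h4 : (0 : ℝ) < √(phiNormSq n) := by positivity
  field_simp
  nlinarith

theorem lower_hermS_zero : lower (hermS 0) = 0 := by
  rw [hermS, map_smul, lower_phiS_zero, smul_zero]

theorem phi_neg (n : ℕ) (x : ℝ) : phi n (-x) = (-1) ^ n * phi n x := by
  induction n generalizing x with
  | zero => simp [phi]
  | succ n ih =>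
    have h : deriv (phi n) (-x) = -((-1) ^ n * deriv (phi n) x) := by
      have h1 : (fun y => phi n (-y)) = fun y => (-1) ^ n * phi n y := funext ih
      have h2 := deriv_comp_neg (phi n) x
      rw [h1, deriv_const_mul_field] at h2
      linarith
    simp only [phi, ih, h]
    ring

theorem hermS_neg (n : ℕ) (x : ℝ) : hermS n (-x) = (-1) ^ n * hermS n x := by
  rw [hermS_apply, hermS_apply, phi_neg, mul_div_assoc]

/-! ### Completeness of the Hermite functions -/

theorem mulX_mem_span_phiS {g : 𝓢(ℝ, ℝ)} (hg : g ∈ Submodule.span ℝ (Set.range phiS)) :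
    mulX g ∈ Submodule.span ℝ (Set.range phiS) := by
  induction hg using Submodule.span_induction with
  | mem g hg =>
    obtain ⟨n, rfl⟩ := hg
    rw [mulX_eq]
    refine Submodule.smul_mem _ _ (Submodule.add_mem _ ?_ ?_)
    · cases n with
      | zero => rw [lower_phiS_zero]; exact Submodule.zero_mem _
      | succ n =>
        rw [lower_phiS_succ]
        exact Submodule.smul_mem _ _ (Submodule.subset_span ⟨n, rfl⟩)
    · exact Submodule.subset_span ⟨n + 1, rfl⟩
  | zero => rw [map_zero]; exact Submodule.zero_mem _
  | add f g _ _ hf hg => rw [map_add]; exact Submodule.add_mem _ hf hg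
  | smul c f _ hf => rw [map_smul]; exact Submodule.smul_mem _ _ hf

theorem exists_mem_span_phiS_eq_pow_mul_gaussian (n : ℕ) :
    ∃ g ∈ Submodule.span ℝ (Set.range phiS), ∀ x, g x = x ^ n * gaussian x := by
  induction n with
  | zero => exact ⟨gaussian, Submodule.subset_span ⟨0, rfl⟩, fun x => by simp⟩
  | succ n ih =>
    obtain ⟨g, hg, hgx⟩ := ih
    exact ⟨mulX g, mulX_mem_span_phiS hg, fun x => by rw [mulX_apply, hgx]; ring⟩

theorem integrable_schwartz_mul {f : ℝ → ℂ} (hf : MemLp f 2) (g : 𝓢(ℝ, ℝ)) :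
    Integrable fun x => (g x : ℂ) * f x := by
  have hg : MemLp (fun x => (g x : ℂ)) 2 := (g.memLp 2 volume).ofReal
  exact hg.integrable_mul hf

theorem integral_pow_mul_gaussian_mul_eq_zero {f : ℝ → ℂ} (hf : MemLp f 2)
    (h : ∀ n, ∫ x, (phi n x : ℂ) * f x = 0) (n : ℕ) :
    ∫ x : ℝ, (x : ℂ) ^ n * ((gaussian x : ℂ) * f x) = 0 := by
  obtain ⟨g, hg, hgx⟩ := exists_mem_span_phiS_eq_pow_mul_gaussian n
  have : ∫ x, (g x : ℂ) * f x = 0 := by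
    clear hgx
    induction hg using Submodule.span_induction with
    | mem g hg =>
      obtain ⟨n, rfl⟩ := hg
      rw [coe_phiS]; exact h n
    | zero => simp
    | add g g' _ _ hg hg' =>
      have : (fun x => (((g + g' : 𝓢(ℝ, ℝ)) x : ℝ) : ℂ) * f x) =
          fun x => (g x : ℂ) * f x + (g' x : ℂ) * f x := by
        ext x; rw [add_apply]; push_cast; ring
      rw [this, integral_add (integrable_schwartz_mul hf g) (integrable_schwartz_mul hf g'),
        hg, hg', add_zero]
    | smul c g _ hg =>
      have : (fun x => (((c • g : 𝓢(ℝ, ℝ)) x : ℝ) : ℂ) * f x) =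
          fun x => (c : ℂ) * ((g x : ℂ) * f x) := by
        ext x; rw [smul_apply, smul_eq_mul]; push_cast; ring
      rw [this, integral_const_mul, hg, mul_zero]
  rw [← this]
  congr 1; ext x
  rw [hgx]; push_cast; ring

theorem integrable_exp_mul_gaussian_mul {f : ℝ → ℂ} (hf : MemLp f 2) (c : ℝ) :
    Integrable fun x => Real.exp (c * |x|) * ‖(gaussian x : ℂ) * f x‖ := by
  have hg : MemLp (fun x : ℝ => Real.exp (c * |x|) * gaussian x) 2 := by
    -- Comparison with `e^{c²} e^{-x²/4}`: the bound `c|x| - x²/2 ≤ c² - x²/4` says `(|x|/2 - c)² ≥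
    -- 0`.
    have hm : MemLp (fun x : ℝ => Real.exp (-x ^ 2 / 4)) 2 := by
      rw [memLp_two_iff_integrable_sq (by fun_prop)]
      refine (integrable_exp_neg_mul_sq (b := 1 / 2) (by norm_num)).congr (.of_forall fun x => ?_)
      simp only [← Real.exp_nat_mul]
      congr 1; push_cast; ring
    refine (hm.const_mul (Real.exp (c ^ 2))).mono
      (by simp only [gaussian_apply]; fun_prop) (.of_forall fun x => ?_)
    rw [gaussian_apply, ← Real.exp_add, ← Real.exp_add, Real.norm_eq_abs, Real.norm_eq_abs,
      Real.abs_exp, Real.abs_exp, Real.exp_le_exp]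
    nlinarith [sq_nonneg (|x| / 2 - c), sq_abs x]
  refine (MemLp.integrable_mul hg hf.norm).congr (.of_forall fun x => ?_)
  simp only [Pi.mul_apply, norm_mul, Complex.norm_real, gaussian_apply, Real.norm_eq_abs,
    Real.abs_exp, mul_assoc]

/-- The exponential is expanded and integrated term by term; every moment vanishes, and `e^{‖z‖|x|}`
times the Gaussian times `|f|` is an integrable majorant. -/
theorem integral_cexp_mul_gaussian_mul_eq_zero {f : ℝ → ℂ} (hf : MemLp f 2)
    (h : ∀ n, ∫ x, (phi n x : ℂ) * f x = 0) (z : ℂ) :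
    ∫ x : ℝ, Complex.exp (z * x) * ((gaussian x : ℂ) * f x) = 0 := by
  set F : ℝ → ℂ := fun x => (gaussian x : ℂ) * f x with hF
  have hFm : AEStronglyMeasurable F :=
    (integrable_schwartz_mul hf gaussian).aestronglyMeasurable
  have hs : ∀ x : ℝ, HasSum (fun n : ℕ => (‖z‖ * |x|) ^ n / n.factorial * ‖F x‖)
      (Real.exp (‖z‖ * |x|) * ‖F x‖) := fun x => by
    have := NormedSpace.expSeries_div_hasSum_exp (‖z‖ * |x|)
    rw [← Real.exp_eq_exp_ℝ] at this
    exact this.mul_right _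
  have key := hasSum_integral_of_dominated_convergence (μ := volume)
    (F := fun (n : ℕ) (x : ℝ) => (z * x) ^ n / n.factorial * F x)
    (f := fun x => Complex.exp (z * x) * F x)
    (fun n x => (‖z‖ * |x|) ^ n / n.factorial * ‖F x‖)
    (fun n => AEStronglyMeasurable.mul (by fun_prop) hFm)
    (fun n => .of_forall fun x => by simp)
    (.of_forall fun x => (hs x).summable)
    ((integrable_exp_mul_gaussian_mul hf ‖z‖).congr (.of_forall fun x => (hs x).tsum_eq.symm))
    (.of_forall fun x => by
      have := NormedSpace.expSeries_div_hasSum_exp (z * x)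
      rw [← Complex.exp_eq_exp_ℂ] at this
      exact this.mul_right _)
  have h0 : ∀ n : ℕ, ∫ x : ℝ, (z * x) ^ n / n.factorial * F x = 0 := fun n => by
    have : (fun x : ℝ => (z * x) ^ n / n.factorial * F x) =
        fun x : ℝ => (z ^ n / n.factorial) * ((x : ℂ) ^ n * F x) := by
      ext x; ring
    rw [this, integral_const_mul, integral_pow_mul_gaussian_mul_eq_zero hf h, mul_zero]
  simp only [h0] at key
  exact key.unique hasSum_zero

/-- Imaginary `z` make the Fourier transform of `F` vanish. A test function is the transform of a
Schwartz function, and the transform can be moved across the pairing onto `F`. -/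
theorem ae_eq_zero_of_fourier_eq_zero {F : ℝ → ℂ} (hF : Integrable F)
    (h : ∀ z : ℂ, ∫ x : ℝ, Complex.exp (z * x) * F x = 0) : F =ᵐ[volume] 0 := by
  have h0 : FourierTransform.fourier F = 0 := by
    ext ξ
    rw [Real.fourier_eq']
    have := h (-2 * Real.pi * Complex.I * ξ)
    simp only [Pi.zero_apply, smul_eq_mul]
    rw [← this]
    congr 1; ext x
    congr 2
    simp; ring
  refine ae_eq_zero_of_integral_contDiff_smul_eq_zero hF.locallyIntegrable fun g hg hgc => ?_
  have hgc' : HasCompactSupport fun x => (g x : ℂ) := hgc.comp_left (g := fun t : ℝ => (t : ℂ)) rfl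
  have hg' : ContDiff ℝ (⊤ : ℕ∞) fun x => (g x : ℂ) := Complex.ofRealCLM.contDiff.comp hg
  let ψ : 𝓢(ℝ, ℂ) := hgc'.toSchwartzMap hg'
  let η : 𝓢(ℝ, ℂ) := FourierTransformInv.fourierInv ψ
  have hη : FourierTransform.fourier (η : ℝ → ℂ) = fun x => (g x : ℂ) := by
    rw [← SchwartzMap.fourier_coe]
    have : FourierTransform.fourier η = ψ := FourierTransform.fourier_fourierInv_eq ψ
    rw [this]; rfl
  have := VectorFourier.integral_fourierIntegral_smul_eq_flip (L := innerₗ ℝ) (μ := volume)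
    (ν := volume) (e := Real.fourierChar) Real.continuous_fourierChar
    (by exact continuous_inner) (η.integrable) hF
  have e1 : ∀ x, VectorFourier.fourierIntegral Real.fourierChar volume (innerₗ ℝ) (η : ℝ → ℂ) x =
      (g x : ℂ) := fun x => congrFun hη x
  have e2 : ∀ x, VectorFourier.fourierIntegral Real.fourierChar volume (innerₗ ℝ).flip F x = 0 := by
    intro x
    rw [flip_innerₗ]
    exact congrFun h0 x
  simp only [e1, e2, smul_zero, integral_zero] at this
  simpa using this

theorem ae_eq_zero_of_integral_phi_mul_eq_zero {f : ℝ → ℂ} (hf : MemLp f 2)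
    (h : ∀ n, ∫ x, (phi n x : ℂ) * f x = 0) : f =ᵐ[volume] 0 := by
  filter_upwards [ae_eq_zero_of_fourier_eq_zero (integrable_schwartz_mul hf gaussian)
    (integral_cexp_mul_gaussian_mul_eq_zero hf h)] with x hx
  refine (mul_eq_zero.1 hx).resolve_left ?_
  rw [gaussian_apply]
  exact_mod_cast (Real.exp_pos _).ne'

theorem span_hermS_orthogonal :
    (Submodule.span ℝ (Set.range fun n => toL2 (hermS n)))ᗮ = ⊥ := by
  rw [Submodule.eq_bot_iff]
  intro f hf
  have hf' : ∀ n, ∫ x, phi n x * f x = 0 := fun n => by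
    have := (Submodule.mem_orthogonal _ _).1 hf _ (Submodule.subset_span ⟨n, rfl⟩)
    simp only [hermS, map_smul, inner_smul_left] at this
    rw [inner_toL2_right, coe_phiS] at this
    have h2 := phiNormSq_pos n
    exact (mul_eq_zero.1 this).resolve_left (by simpa using by positivity)
  have h0 := ae_eq_zero_of_integral_phi_mul_eq_zero (Lp.memLp f).ofReal fun n => by
    have : ∀ x : ℝ, (phi n x : ℂ) * ((RCLike.ofReal (f x) : ℂ)) = ((phi n x * f x : ℝ) : ℂ) := by
      intro x; push_cast; rfl
    simp only [this]
    rw [integral_complex_ofReal, hf']; rfl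
  rw [Lp.eq_zero_iff_ae_eq_zero]
  filter_upwards [h0] with x hx
  simpa using hx

/-- The Hilbert basis of Hermite functions. -/
def herm : HilbertBasis ℕ ℝ L2R :=
  HilbertBasis.mkOfOrthogonalEqBot orthonormal_hermS span_hermS_orthogonal

theorem herm_apply (n : ℕ) : herm n = toL2 (hermS n) := by
  rw [herm, HilbertBasis.coe_mkOfOrthogonalEqBot]

/-! ### Schwartz functions and rapidly decreasing Hermite coefficients -/

/-- One-dimensional Sobolev inequality: `f(x)²` is the integral of `2 f f'` over `(-∞, x]`, and `2 f
f' ≤ f² + f'²`. -/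
theorem sq_le_norm_sq_add_norm_diffS_sq (f : 𝓢(ℝ, ℝ)) (x : ℝ) :
    f x ^ 2 ≤ ‖toL2 f‖ ^ 2 + ‖toL2 (diffS f)‖ ^ 2 := by
  have hi : ∀ g h : 𝓢(ℝ, ℝ), Integrable fun x => g x * h x := fun g h =>
    MemLp.integrable_mul (g.memLp 2 volume) (h.memLp 2 volume)
  have h1 : ∫ y in Set.Iic x, 2 * (f y * diffS f y) = f x ^ 2 - 0 := by
    refine integral_Iic_of_hasDerivAt_of_tendsto (f := fun y => f y ^ 2)
      (by fun_prop) (fun y _ => ?_) ((hi f (diffS f)).const_mul 2).integrableOn ?_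
    · convert! (f.hasDerivAt y).pow 2 using 1
      rw [diffS_apply]; push_cast; ring
    · have := (f.tendsto_cocompact).mono_left (atBot_le_cocompact (α := ℝ))
      simpa using this.pow 2
  rw [sub_zero] at h1
  rw [← h1, ← real_inner_self_eq_norm_sq, ← real_inner_self_eq_norm_sq, inner_toL2, inner_toL2,
    ← integral_add (hi f f) (hi (diffS f) (diffS f))]
  calc _ ≤ ∫ y in Set.Iic x, (f y * f y + diffS f y * diffS f y) :=
        integral_mono ((hi f (diffS f)).const_mul 2).integrableOn
          ((hi f f).add (hi (diffS f) (diffS f))).integrableOn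
          fun y => by
            simp only
            nlinarith [sq_nonneg (f y - diffS f y)]
    _ ≤ _ := setIntegral_le_integral ((hi f f).add (hi (diffS f) (diffS f)))
          (.of_forall fun y => by
            simp only [Pi.zero_apply]
            nlinarith [sq_nonneg (f y), sq_nonneg (diffS f y)])

/-- `T h_M` is bounded by a power of `M + 1`, uniformly in the space variable. -/
def HermiteGrowth (T : 𝓢(ℝ, ℝ) →L[ℝ] 𝓢(ℝ, ℝ)) : Prop :=
  ∃ (K : ℝ) (r : ℕ), 0 ≤ K ∧ ∀ (M : ℕ) (x : ℝ), |T (hermS M) x| ≤ K * ((M : ℝ) + 1) ^ r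

theorem norm_toL2_hermS (n : ℕ) : ‖toL2 (hermS n)‖ = 1 := orthonormal_hermS.1 n

theorem sqrt_add_one_le (M : ℕ) : √((M : ℝ) + 1) ≤ (M : ℝ) + 1 := by
  have : (0 : ℝ) ≤ M := by positivity
  exact Real.sqrt_le_iff.2 ⟨by positivity, by nlinarith⟩

/-- A ladder operator moves `h_M` to a neighbour at the cost of a factor of order `√M`, so
polynomial growth survives with the exponent raised by one. As `x` and `d/dx` are combinations of
ladder operators, all Schwartz seminorms of `h_M` grow polynomially. -/
theorem HermiteGrowth.comp_lower {T : 𝓢(ℝ, ℝ) →L[ℝ] 𝓢(ℝ, ℝ)} (hT : HermiteGrowth T) :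
    HermiteGrowth (T * lower) := by
  obtain ⟨K, r, hK, h⟩ := hT
  refine ⟨K, r + 1, hK, fun M x => ?_⟩
  cases M with
  | zero => simp [lower_hermS_zero, hK]
  | succ M =>
    rw [mul_apply_eq_comp, lower_hermS_succ, map_smul, smul_apply, smul_eq_mul,
      abs_mul, abs_of_nonneg (Real.sqrt_nonneg _)]
    calc _ ≤ ((M : ℝ) + 1) * (K * ((M : ℝ) + 1) ^ r) := by
          gcongr
          · exact sqrt_add_one_le M
          · exact h M x
      _ = K * ((M : ℝ) + 1) ^ (r + 1) := by ring
      _ ≤ _ := by gcongr; linarith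

theorem HermiteGrowth.comp_raise {T : 𝓢(ℝ, ℝ) →L[ℝ] 𝓢(ℝ, ℝ)} (hT : HermiteGrowth T) :
    HermiteGrowth (T * raise) := by
  obtain ⟨K, r, hK, h⟩ := hT
  refine ⟨K * 2 ^ r, r + 1, by positivity, fun M x => ?_⟩
  rw [mul_apply_eq_comp, raise_hermS, map_smul, smul_apply, smul_eq_mul,
    abs_mul, abs_of_nonneg (Real.sqrt_nonneg _)]
  calc _ ≤ ((M : ℝ) + 1) * (K * (((M + 1 : ℕ) : ℝ) + 1) ^ r) := by
        gcongr
        · exact sqrt_add_one_le M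
        · exact h (M + 1) x
    _ ≤ ((M : ℝ) + 1) * (K * (2 * ((M : ℝ) + 1)) ^ r) := by
        gcongr
        push_cast
        have : (0 : ℝ) ≤ M := by positivity
        linarith
    _ = _ := by rw [mul_pow]; ring

theorem HermiteGrowth.smul {T : 𝓢(ℝ, ℝ) →L[ℝ] 𝓢(ℝ, ℝ)} (hT : HermiteGrowth T) (c : ℝ) :
    HermiteGrowth (c • T) := by
  obtain ⟨K, r, hK, h⟩ := hT
  refine ⟨|c| * K, r, by positivity, fun M x => ?_⟩
  rw [smul_apply, smul_apply, smul_eq_mul, abs_mul, mul_assoc]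
  exact mul_le_mul_of_nonneg_left (h M x) (abs_nonneg c)

theorem HermiteGrowth.add {T T' : 𝓢(ℝ, ℝ) →L[ℝ] 𝓢(ℝ, ℝ)} (hT : HermiteGrowth T)
    (hT' : HermiteGrowth T') : HermiteGrowth (T + T') := by
  obtain ⟨K, r, hK, h⟩ := hT
  obtain ⟨K', r', hK', h'⟩ := hT'
  refine ⟨K + K', r + r', by positivity, fun M x => ?_⟩
  rw [add_apply, add_apply, add_mul]
  have h1 : (1 : ℝ) ≤ M + 1 := by simp
  refine (abs_add_le _ _).trans (add_le_add ((h M x).trans ?_) ((h' M x).trans ?_))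
  · gcongr; all_goals simp
  · gcongr; all_goals simp

theorem mulX_eq_lower_add_raise : mulX = (√2)⁻¹ • (lower + raise) :=
  ContinuousLinearMap.ext mulX_eq

theorem diffS_eq_lower_add_neg_raise : diffS = (√2)⁻¹ • (lower + (-1 : ℝ) • raise) :=
  ContinuousLinearMap.ext fun f => by
    rw [diffS_eq]; simp [sub_eq_add_neg]

theorem HermiteGrowth.comp_mulX {T : 𝓢(ℝ, ℝ) →L[ℝ] 𝓢(ℝ, ℝ)} (hT : HermiteGrowth T) :
    HermiteGrowth (T * mulX) := by
  rw [mulX_eq_lower_add_raise, mul_smul_comm, mul_add]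
  exact (hT.comp_lower.add hT.comp_raise).smul _

theorem HermiteGrowth.comp_diffS {T : 𝓢(ℝ, ℝ) →L[ℝ] 𝓢(ℝ, ℝ)} (hT : HermiteGrowth T) :
    HermiteGrowth (T * diffS) := by
  rw [diffS_eq_lower_add_neg_raise, mul_smul_comm, mul_add, mul_smul_comm]
  exact (hT.comp_lower.add (hT.comp_raise.smul _)).smul _

theorem norm_toL2_diffS_hermS_le (M : ℕ) : ‖toL2 (diffS (hermS M))‖ ≤ 2 * ((M : ℝ) + 1) := by
  have h2 : (√2 : ℝ)⁻¹ ≤ 1 := inv_le_one_of_one_le₀ (by rw [Real.one_le_sqrt]; norm_num)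
  have hl : ‖toL2 (lower (hermS M))‖ ≤ (M : ℝ) + 1 := by
    cases M with
    | zero => simp [lower_hermS_zero]
    | succ M =>
      rw [lower_hermS_succ, map_smul, norm_smul, norm_toL2_hermS, mul_one, Real.norm_eq_abs,
        abs_of_nonneg (Real.sqrt_nonneg _)]
      exact (sqrt_add_one_le M).trans (by push_cast; linarith)
  have hr : ‖toL2 (raise (hermS M))‖ ≤ (M : ℝ) + 1 := by
    rw [raise_hermS, map_smul, norm_smul, norm_toL2_hermS, mul_one, Real.norm_eq_abs,
      abs_of_nonneg (Real.sqrt_nonneg _)]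
    exact sqrt_add_one_le M
  rw [diffS_eq, map_smul, map_sub, norm_smul, Real.norm_eq_abs, abs_of_nonneg (by positivity)]
  calc _ ≤ 1 * (((M : ℝ) + 1) + (M + 1)) := by
        gcongr
        exact (norm_sub_le _ _).trans (add_le_add hl hr)
    _ = _ := by ring

theorem HermiteGrowth.one : HermiteGrowth 1 := by
  -- The Sobolev bound gives `1 + 4(M + 1)² ≤ (3(M + 1))²`.
  refine ⟨3, 1, by norm_num, fun M x => ?_⟩
  rw [one_apply_eq_self, pow_one]
  refine abs_le_of_sq_le_sq ((sq_le_norm_sq_add_norm_diffS_sq (hermS M) x).trans ?_)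
    (by positivity)
  rw [norm_toL2_hermS]
  have h := norm_toL2_diffS_hermS_le M
  have h0 : (0 : ℝ) ≤ M := by positivity
  nlinarith [norm_nonneg (toL2 (diffS (hermS M)))]

theorem HermiteGrowth.mulX_pow_mul_diffS_pow (k l : ℕ) : HermiteGrowth (mulX ^ k * diffS ^ l) := by
  induction l with
  | zero =>
    rw [pow_zero, mul_one]
    induction k with
    | zero => rw [pow_zero]; exact .one
    | succ k ih => rw [pow_succ]; exact ih.comp_mulX
  | succ l ih => rw [pow_succ, ← mul_assoc]; exact ih.comp_diffS

theorem mulX_pow_apply (k : ℕ) (f : 𝓢(ℝ, ℝ)) (x : ℝ) : (mulX ^ k) f x = x ^ k * f x := by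
  induction k with
  | zero => simp
  | succ k ih =>
    rw [pow_succ', mul_apply_eq_comp, mulX_apply, ih]; ring

theorem diffS_pow_apply (l : ℕ) (f : 𝓢(ℝ, ℝ)) (x : ℝ) : (diffS ^ l) f x = iteratedDeriv l f x := by
  induction l generalizing x with
  | zero => simp
  | succ l ih =>
    rw [pow_succ', mul_apply_eq_comp, diffS_apply, iteratedDeriv_succ]
    congr 1; ext y; exact ih y

theorem exists_bound_hermS (k l : ℕ) : ∃ (K : ℝ) (r : ℕ), 0 ≤ K ∧ ∀ (M : ℕ) (x : ℝ),
    ‖x‖ ^ k * ‖iteratedFDeriv ℝ l (hermS M) x‖ ≤ K * ((M : ℝ) + 1) ^ r := by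
  obtain ⟨K, r, hK, h⟩ := HermiteGrowth.mulX_pow_mul_diffS_pow k l
  refine ⟨K, r, hK, fun M x => le_trans (le_of_eq ?_) (h M x)⟩
  rw [mul_apply_eq_comp, mulX_pow_apply, diffS_pow_apply, abs_mul, abs_pow,
    norm_iteratedFDeriv_eq_norm_iteratedDeriv, Real.norm_eq_abs, Real.norm_eq_abs]

/-- Rapid decrease of a sequence. -/
def RapidDecay (c : ℕ → ℝ) : Prop := ∀ r : ℕ, ∃ K : ℝ, ∀ M : ℕ, |c M| * ((M : ℝ) + 1) ^ r ≤ K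

theorem RapidDecay.exists_summable_bound {c : ℕ → ℝ} (hc : RapidDecay c) (k l : ℕ) :
    ∃ b : ℕ → ℝ, Summable b ∧ ∀ (M : ℕ) (x : ℝ),
      ‖x‖ ^ k * ‖iteratedFDeriv ℝ l (fun y => c M * hermS M y) x‖ ≤ b M := by
  obtain ⟨K, r, hK, h⟩ := exists_bound_hermS k l
  -- Two powers beyond the growth `r` of the seminorm leave the summable factor `1/(M + 1)²`.
  obtain ⟨K', hK'⟩ := hc (r + 2)
  refine ⟨fun M => K * K' * (1 / ((M : ℝ) + 1) ^ 2), ?_, fun M x => ?_⟩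
  · have := (summable_nat_add_iff 1).2 (Real.summable_one_div_nat_pow.2 one_lt_two)
    exact (this.mul_left (K * K')).congr fun M => by push_cast; rfl
  · have e : iteratedFDeriv ℝ l (fun y => c M * hermS M y) x =
        c M • iteratedFDeriv ℝ l (hermS M) x :=
      iteratedFDeriv_const_smul_apply (a := c M) ((hermS M).contDiffAt l)
    have hp : (0 : ℝ) < (M : ℝ) + 1 := by positivity
    rw [e, norm_smul, Real.norm_eq_abs (c M)]
    calc _ = |c M| * (‖x‖ ^ k * ‖iteratedFDeriv ℝ l (hermS M) x‖) := by ring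
      _ ≤ |c M| * (K * ((M : ℝ) + 1) ^ r) :=
        mul_le_mul_of_nonneg_left (h M x) (abs_nonneg _)
      _ = K * (|c M| * ((M : ℝ) + 1) ^ (r + 2)) * (1 / ((M : ℝ) + 1) ^ 2) := by
        field_simp; ring
      _ ≤ _ := mul_le_mul_of_nonneg_right (mul_le_mul_of_nonneg_left (hK' M) hK) (by positivity)

/-- The Schwartz function with given rapidly decreasing Hermite coefficients. -/
def RapidDecay.toSchwartz {c : ℕ → ℝ} (hc : RapidDecay c) : 𝓢(ℝ, ℝ) where
  toFun x := ∑' M, c M * hermS M x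
  smooth' := by
    choose b hb hbb using fun l => hc.exists_summable_bound 0 l
    exact contDiff_tsum (N := ⊤) (fun M => contDiff_const.mul ((hermS M).smooth ⊤))
      (fun l _ => hb l) fun l M x _ => by simpa using hbb l M x
  decay' k l := by
    choose b hb hbb using fun l => hc.exists_summable_bound 0 l
    obtain ⟨b', hb', hbb'⟩ := hc.exists_summable_bound k l
    refine ⟨∑' M, b' M, fun x => ?_⟩
    rw [iteratedFDeriv_tsum_apply (N := ⊤) (fun M => contDiff_const.mul ((hermS M).smooth ⊤))
      (fun l _ => hb l) (fun l M x _ => by simpa using hbb l M x) le_top]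
    rw [← norm_pow, ← norm_smul, ← tsum_const_smul'']
    exact tsum_of_norm_bounded hb'.hasSum fun M => by
      rw [norm_smul, norm_pow]; exact hbb' M x

theorem RapidDecay.inner_toSchwartz {c : ℕ → ℝ} (hc : RapidDecay c) (M : ℕ) :
    inner ℝ (toL2 (hermS M)) (toL2 hc.toSchwartz) = c M := by
  obtain ⟨b, hb, hbb⟩ := hc.exists_summable_bound 0 0
  have hb' : ∀ K x, ‖c K * hermS K x‖ ≤ b K := fun K x => by simpa using hbb K x
  have hs : ∀ x, Summable fun K => c K * hermS K x := fun x =>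
    Summable.of_norm_bounded hb fun K => hb' K x
  have key := hasSum_integral_of_dominated_convergence (μ := volume)
    (F := fun (K : ℕ) (x : ℝ) => hermS M x * (c K * hermS K x))
    (f := fun x => hermS M x * hc.toSchwartz x)
    (fun K x => ‖hermS M x‖ * b K)
    (fun K => by fun_prop)
    (fun K => .of_forall fun x => by
      rw [norm_mul]; exact mul_le_mul_of_nonneg_left (hb' K x) (norm_nonneg _))
    (.of_forall fun x => hb.mul_left _)
    (by simp only [tsum_mul_left]; exact (hermS M).integrable.norm.mul_const _)
    (.of_forall fun x => (hs x).hasSum.mul_left _)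
  rw [inner_toL2]
  refine key.unique ?_
  have h2 : ∀ K, ∫ x, hermS M x * (c K * hermS K x) = if K = M then c M else 0 := fun K => by
    have e : ∀ x, hermS M x * (c K * hermS K x) = c K * (hermS M x * hermS K x) := fun x => by ring
    simp only [e]
    rw [integral_const_mul, ← inner_toL2]
    have := orthonormal_iff_ite.1 orthonormal_hermS M K
    rw [this]
    by_cases h : M = K
    · subst h; simp
    · simp [h, Ne.symm h]
  simp only [h2]
  exact hasSum_ite_eq M (c M)

theorem inner_hermS_osc_pow (f : 𝓢(ℝ, ℝ)) (M r : ℕ) :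
    inner ℝ (toL2 (hermS M)) (toL2 ((osc ^ r) f)) =
      ((M : ℝ) + 1 / 2) ^ r * inner ℝ (toL2 (hermS M)) (toL2 f) := by
  induction r with
  | zero => simp
  | succ r ih =>
    rw [pow_succ', mul_apply_eq_comp, ← inner_osc, osc_hermS, map_smul,
      inner_smul_left, ih, conj_trivial]
    ring

/-- Powers of the symmetric oscillator can be moved onto `f`, each gaining a factor `M + 1/2`; the
constant `2^r` comes from `M + 1 ≤ 2(M + 1/2)`. -/
theorem rapidDecay_inner_toL2 (f : 𝓢(ℝ, ℝ)) :
    RapidDecay fun M => inner ℝ (toL2 (hermS M)) (toL2 f) := by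
  intro r
  refine ⟨2 ^ r * ‖toL2 ((osc ^ r) f)‖, fun M => ?_⟩
  have h := abs_real_inner_le_norm (toL2 (hermS M)) (toL2 ((osc ^ r) f))
  have h0 : (0 : ℝ) ≤ M := by positivity
  rw [norm_toL2_hermS, one_mul, inner_hermS_osc_pow, abs_mul, abs_of_nonneg (by positivity)] at h
  calc _ ≤ |inner ℝ (toL2 (hermS M)) (toL2 f)| * (2 * ((M : ℝ) + 1 / 2)) ^ r := by
        gcongr; linarith
    _ = 2 ^ r * (((M : ℝ) + 1 / 2) ^ r * |inner ℝ (toL2 (hermS M)) (toL2 f)|) := by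
        rw [mul_pow]; ring
    _ ≤ _ := by gcongr

/-- The `L²` functions that have a Schwartz representative. -/
def schwartzL2 : Submodule ℝ L2R := LinearMap.range (toL2 : 𝓢(ℝ, ℝ) →ₗ[ℝ] L2R)

/-- This reduces regularity to a condition on coefficients, which a bounded diagonal operator such
as the reduced resolvent visibly preserves. -/
theorem mem_schwartzL2_iff_rapidDecay {f : L2R} :
    f ∈ schwartzL2 ↔ RapidDecay fun M => inner ℝ (herm M) f := by
  simp only [herm_apply]
  constructor
  · rintro ⟨g, rfl⟩
    exact rapidDecay_inner_toL2 g
  · intro h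
    refine ⟨h.toSchwartz, ?_⟩
    refine herm.repr.injective (lp.ext (funext fun M => ?_))
    rw [HilbertBasis.repr_apply_apply, HilbertBasis.repr_apply_apply, herm_apply]
    exact h.inner_toSchwartz M

/-! ### The reduced resolvent -/

/-- Distinct integers are at distance at least `1`. For `M = N` the convention `0⁻¹ = 0` is what
makes the resolvent below annihilate `h_N`. -/
theorem abs_inv_natCast_sub_le_one (M N : ℕ) : |((M : ℝ) - N)⁻¹| ≤ 1 := by
  rcases eq_or_ne M N with rfl | h
  · simp
  · rw [abs_inv]
    refine inv_le_one_of_one_le₀ ?_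
    have : (1 : ℤ) ≤ |(M : ℤ) - N| := Int.one_le_abs (sub_ne_zero.2 (by exact_mod_cast h))
    exact_mod_cast this

theorem memℓp_resolventCoeff (N : ℕ) (c : lp (fun _ : ℕ => ℝ) 2) :
    Memℓp (fun M : ℕ => ((M : ℝ) - N)⁻¹ * c M) 2 :=
  (lp.memℓp c).norm.mono fun M => by
    rw [norm_mul]
    exact mul_le_of_le_one_left (norm_nonneg _) (abs_inv_natCast_sub_le_one M N)

/-- The reduced resolvent `∑_{M ≠ N} (M - N)⁻¹ ⟨h_M, ·⟩ h_M` of the oscillator at `N + 1/2`. -/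
def resolvent (N : ℕ) : L2R →L[ℝ] L2R :=
  LinearMap.mkContinuous
    { toFun := fun f => herm.repr.symm ⟨_, memℓp_resolventCoeff N (herm.repr f)⟩
      map_add' := fun f g => by
        rw [← map_add]; congr 1; ext M
        simp only [map_add, lp.coeFn_add, Pi.add_apply]; exact mul_add _ _ _
      map_smul' := fun a f => by
        rw [← map_smul]; congr 1; ext M
        simp; ring } 1 fun f => by
    simp only [LinearMap.coe_mk, AddHom.coe_mk, LinearIsometryEquiv.norm_map, one_mul]
    rw [← herm.repr.norm_map f]
    refine lp.norm_mono (by norm_num) fun M => ?_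
    simp only [norm_mul]
    exact mul_le_of_le_one_left (norm_nonneg _) (abs_inv_natCast_sub_le_one M N)

theorem norm_resolvent_le (N : ℕ) : ‖resolvent N‖ ≤ 1 :=
  LinearMap.mkContinuous_norm_le _ zero_le_one _

theorem inner_herm_resolvent (N M : ℕ) (f : L2R) :
    inner ℝ (herm M) (resolvent N f) = ((M : ℝ) - N)⁻¹ * inner ℝ (herm M) f := by
  rw [← HilbertBasis.repr_apply_apply, ← HilbertBasis.repr_apply_apply]
  simp [resolvent]

theorem resolvent_herm (N M : ℕ) : resolvent N (herm M) = ((M : ℝ) - N)⁻¹ • herm M := by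
  refine herm.repr.injective (lp.ext (funext fun K => ?_))
  rw [HilbertBasis.repr_apply_apply, HilbertBasis.repr_apply_apply, inner_herm_resolvent,
    inner_smul_right, orthonormal_iff_ite.1 herm.orthonormal]
  split_ifs with h
  · rw [h]
  · simp

theorem resolvent_mem_schwartzL2 (N : ℕ) {f : L2R} (hf : f ∈ schwartzL2) :
    resolvent N f ∈ schwartzL2 := by
  rw [mem_schwartzL2_iff_rapidDecay] at hf ⊢
  intro r
  obtain ⟨K, hK⟩ := hf r
  refine ⟨K, fun M => le_trans ?_ (hK M)⟩
  simp only
  rw [inner_herm_resolvent, abs_mul]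
  gcongr
  exact mul_le_of_le_one_left (abs_nonneg _) (abs_inv_natCast_sub_le_one M N)

/-! ### Power series with coefficients in a normed space -/

theorem hasSum_sum_antidiagonal_smul {E : Type*} [NormedAddCommGroup E] [NormedSpace ℝ E]
    [CompleteSpace E] {a : ℕ → ℝ} {v : ℕ → E} {A : ℝ} {W : E} (ha : HasSum a A)
    (hv : HasSum v W) (hvn : Summable fun n => ‖v n‖) :
    HasSum (fun n => ∑ p ∈ Finset.HasAntidiagonal.antidiagonal n, a p.1 • v p.2) (A • W) := by
  have hs : Summable fun p : ℕ × ℕ => a p.1 • v p.2 := by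
    refine Summable.of_norm ?_
    simp only [norm_smul]
    exact Summable.mul_of_nonneg ha.summable.norm hvn (fun _ => norm_nonneg _)
      fun _ => norm_nonneg _
  have h := ha.smul hv hs
  rw [← Finset.HasAntidiagonal.sigmaAntidiagonalEquivProd.hasSum_iff] at h
  refine h.sigma fun n => ?_
  convert! hasSum_fintype _ using 1
  rw [← Finset.sum_coe_sort]
  rfl

theorem hasSum_pow_smul_sum_antidiagonal {E : Type*} [NormedAddCommGroup E] [NormedSpace ℝ E]
    [CompleteSpace E] {a : ℕ → ℝ} {v : ℕ → E} {A ε : ℝ} {W : E}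
    (ha : HasSum (fun n => a n * ε ^ n) A) (hv : HasSum (fun n => ε ^ n • v n) W)
    (hvn : Summable fun n => ‖ε ^ n • v n‖) :
    HasSum (fun n => ε ^ n • ∑ p ∈ Finset.HasAntidiagonal.antidiagonal n, a p.1 • v p.2) (A • W) := by
  refine (hasSum_sum_antidiagonal_smul ha hv hvn).congr_fun ?_
  intro n
  rw [Finset.smul_sum]
  refine Finset.sum_congr rfl fun p hp => ?_
  rw [← Finset.HasAntidiagonal.mem_antidiagonal.1 hp, pow_add, smul_smul, smul_smul]
  congr 1; ring

theorem hasFPowerSeriesOnBall_of_hasSum {E : Type*} [NormedAddCommGroup E] [NormedSpace ℝ E]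
    {v : ℕ → E} {f : ℝ → E} {c : ℝ} (hc : 0 < c)
    (h : ∀ ε : ℝ, |ε| < c → HasSum (fun n => ε ^ n • v n) (f ε)) :
    HasFPowerSeriesOnBall f (fun n => ContinuousMultilinearMap.mkPiRing ℝ (Fin n) (v n)) 0
      (ENNReal.ofReal c) where
  r_le := by
    refine ENNReal.le_of_forall_nnreal_lt fun r hr => ?_
    have hr' : |(r : ℝ)| < c := by
      rw [abs_of_nonneg r.coe_nonneg]
      have := (ENNReal.ofReal_lt_ofReal_iff hc (p := (r : ℝ))).1
      rw [ENNReal.ofReal_coe_nnreal] at this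
      exact this hr
    have ht := (h r hr').summable.tendsto_atTop_zero.norm
    refine FormalMultilinearSeries.le_radius_of_tendsto _ (l := ‖(0 : E)‖) (ht.congr fun n => ?_)
    rw [norm_smul, ContinuousMultilinearMap.norm_mkPiRing, norm_pow, Real.norm_eq_abs,
      abs_of_nonneg r.coe_nonneg, mul_comm]
  r_pos := by simpa using hc
  hasSum := fun {y} hy => by
    have hy' : |y| < c := by
      rw [Metric.mem_eball, edist_zero_right, ← ofReal_norm,
        ENNReal.ofReal_lt_ofReal_iff hc] at hy
      exact hy
    simpa using h y hy'

theorem analyticOnNhd_of_hasSum {E : Type*} [NormedAddCommGroup E] [NormedSpace ℝ E]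
    [CompleteSpace E] {v : ℕ → E} {f : ℝ → E} {c : ℝ} (hc : 0 < c)
    (h : ∀ ε : ℝ, |ε| < c → HasSum (fun n => ε ^ n • v n) (f ε)) :
    AnalyticOnNhd ℝ f (Set.Ioo (-c) c) := by
  have := (hasFPowerSeriesOnBall_of_hasSum hc h).analyticOnNhd
  refine this.mono fun x hx => ?_
  rw [Metric.eball_ofReal, Metric.mem_ball, dist_zero_right, Real.norm_eq_abs, abs_lt]
  exact hx

theorem exists_hasSum_of_analyticAt {q : ℝ → ℝ} (hq : AnalyticAt ℝ q 0) :
    ∃ r > 0, ∃ a : ℕ → ℝ, ∀ ε : ℝ, |ε| < r → HasSum (fun n => a n * ε ^ n) (q ε) := by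
  obtain ⟨p, hp⟩ := hq
  have h := hasFPowerSeriesAt_iff.1 hp
  obtain ⟨r, hr, h⟩ := Metric.eventually_nhds_iff.1 h
  refine ⟨r, hr, p.coeff, fun ε hε => ?_⟩
  have := h (y := ε) (by simpa using hε)
  simpa [mul_comm] using this

/-! ### Rayleigh–Schrödinger series at a simple eigenvalue -/

section RayleighSchroedinger

variable {H : Type*} [NormedAddCommGroup H] [InnerProductSpace ℝ H]

/-- The Rayleigh–Schrödinger coefficients of the eigenvector, in intermediate normalisation, for the
perturbation `C`, the unperturbed eigenvector `h` and the reduced resolvent `S`. -/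
def rsCoeff (C S : H →L[ℝ] H) (h : H) : ℕ → H
  | 0 => h
  | k + 1 => S ((∑ i : Fin (k + 1),
      inner ℝ h (C (rsCoeff C S h i)) • rsCoeff C S h (k - i)) - C (rsCoeff C S h k))

theorem rsCoeff_zero (C S : H →L[ℝ] H) (h : H) : rsCoeff C S h 0 = h := by
  rw [rsCoeff]

/-- This compares coefficients of `ε^(k+1)` in `U = h + S(ε ⟨h, C U⟩ U - ε C U)`; the sum is the
Cauchy product of `⟨h, C U⟩` and `U`. -/
theorem rsCoeff_succ (C S : H →L[ℝ] H) (h : H) (k : ℕ) :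
    rsCoeff C S h (k + 1) = S ((∑ p ∈ Finset.HasAntidiagonal.antidiagonal k,
      inner ℝ h (C (rsCoeff C S h p.1)) • rsCoeff C S h p.2) - C (rsCoeff C S h k)) := by
  rw [rsCoeff, Finset.Nat.sum_antidiagonal_eq_sum_range_succ
    fun i j => inner ℝ h (C (rsCoeff C S h i)) • rsCoeff C S h j, Finset.sum_range]

theorem rsCoeff_mem {C S : H →L[ℝ] H} {h : H} {V : Submodule ℝ H} (hV : h ∈ V)
    (hC : ∀ f ∈ V, C f ∈ V) (hS : ∀ f ∈ V, S f ∈ V) (k : ℕ) : rsCoeff C S h k ∈ V := by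
  induction k using Nat.strong_induction_on with
  | _ k ih =>
    cases k with
    | zero => rwa [rsCoeff_zero]
    | succ k =>
      rw [rsCoeff_succ]
      refine hS _
        (V.sub_mem (V.sum_mem fun p hp => V.smul_mem _ (ih _ ?_)) (hC _ (ih _ (by omega))))
      have := Finset.HasAntidiagonal.mem_antidiagonal.1 hp
      omega

/-- Since `‖v₀‖ = 1`, the norm `‖v_k‖` is itself a summand of `∑ ‖v_i‖ ‖v_{k-i}‖`. Both parts of the
recursion are thus at most `b` times this sum, which leaves the Catalan recursion with factor `2b`.
-/
theorem norm_rsCoeff_le_catalan {C S : H →L[ℝ] H} {h : H} {b : ℝ} (hC : ‖C‖ ≤ b) (hS : ‖S‖ ≤ 1)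
    (hh : ‖h‖ = 1) (k : ℕ) : ‖rsCoeff C S h k‖ ≤ (2 * b) ^ k * catalan k := by
  have hb : 0 ≤ b := (norm_nonneg _).trans hC
  induction k using Nat.strong_induction_on with
  | _ k ih =>
    cases k with
    | zero => simp [rsCoeff_zero, hh]
    | succ k =>
      have hCf : ∀ f, ‖C f‖ ≤ b * ‖f‖ := fun f => C.le_of_opNorm_le hC f
      have h1 : ‖rsCoeff C S h k‖ ≤
          ∑ p ∈ Finset.HasAntidiagonal.antidiagonal k, ‖rsCoeff C S h p.1‖ * ‖rsCoeff C S h p.2‖ := by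
        refine le_trans (le_of_eq ?_) (Finset.single_le_sum
          (f := fun p : ℕ × ℕ => ‖rsCoeff C S h p.1‖ * ‖rsCoeff C S h p.2‖)
          (fun p _ => by positivity) 
          (show ((k, 0) : ℕ × ℕ) ∈ _ from Finset.HasAntidiagonal.mem_antidiagonal.2 (add_zero k)))
        simp [rsCoeff_zero, hh]
      have h2 : ∑ p ∈ Finset.HasAntidiagonal.antidiagonal k,
          ‖rsCoeff C S h p.1‖ * ‖rsCoeff C S h p.2‖ ≤
          (2 * b) ^ k * catalan (k + 1) := by
        rw [catalan_succ']
        push_cast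
        rw [Finset.mul_sum]
        refine Finset.sum_le_sum fun p hp => ?_
        have hp' := Finset.HasAntidiagonal.mem_antidiagonal.1 hp
        calc _ ≤ ((2 * b) ^ p.1 * catalan p.1) * ((2 * b) ^ p.2 * catalan p.2) := by
              gcongr
              · exact ih _ (by omega)
              · exact ih _ (by omega)
          _ = (2 * b) ^ (p.1 + p.2) * (catalan p.1 * catalan p.2) := by rw [pow_add]; ring
          _ = _ := by rw [hp']
      have h3 : ‖∑ p ∈ Finset.HasAntidiagonal.antidiagonal k,
          inner ℝ h (C (rsCoeff C S h p.1)) • rsCoeff C S h p.2‖ ≤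
          b * ∑ p ∈ Finset.HasAntidiagonal.antidiagonal k, ‖rsCoeff C S h p.1‖ * ‖rsCoeff C S h p.2‖ := by
        rw [Finset.mul_sum]
        refine norm_sum_le_of_le _ fun p _ => ?_
        rw [norm_smul, ← mul_assoc]
        gcongr
        refine (norm_inner_le_norm _ _).trans ?_
        rw [hh, one_mul]; exact hCf _
      rw [rsCoeff_succ]
      refine (S.le_of_opNorm_le hS _).trans ?_
      rw [one_mul]
      calc _ ≤ _ := norm_sub_le _ _
        _ ≤ b * ((2 * b) ^ k * catalan (k + 1)) + b * ((2 * b) ^ k * catalan (k + 1)) := by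
            refine add_le_add (h3.trans ?_) ((hCf _).trans ?_)
            · gcongr
            · gcongr; exact h1.trans h2
        _ = _ := by ring

theorem norm_rsCoeff_le {C S : H →L[ℝ] H} {h : H} {b : ℝ} (hC : ‖C‖ ≤ b) (hS : ‖S‖ ≤ 1)
    (hh : ‖h‖ = 1) (k : ℕ) : ‖rsCoeff C S h k‖ ≤ (8 * b) ^ k := by
  have hb : 0 ≤ b := (norm_nonneg _).trans hC
  refine (norm_rsCoeff_le_catalan hC hS hh k).trans ?_
  have h1 : catalan k ≤ 4 ^ k := by
    rw [catalan_eq_centralBinom_div]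
    exact (Nat.div_le_self _ _).trans (Nat.centralBinom_le_four_pow k)
  calc _ ≤ (2 * b) ^ k * 4 ^ k := by gcongr; exact_mod_cast h1
    _ = _ := by rw [← mul_pow]; congr 1; ring

/-- The unbounded operator enters only through `S`. When `S` is its reduced resolvent at the
eigenvalue of `h`, the last two identities say that `u ε` is an eigenvector with eigenvalue shifted
by `μ ε`. -/
theorem exists_perturbed_eigenvector [CompleteSpace H] {C S : H →L[ℝ] H} {h : H} (hS : ‖S‖ ≤ 1)
    (hh : ‖h‖ = 1) (hSh : ∀ f, inner ℝ h (S f) = 0) {V : Submodule ℝ H} (hV : h ∈ V)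
    (hVC : ∀ f ∈ V, C f ∈ V) (hVS : ∀ f ∈ V, S f ∈ V) :
    ∃ c > 0, ∃ (m : ℕ → ℝ) (w : ℕ → H) (μ : ℝ → ℝ) (u : ℝ → H),
      m 0 = 0 ∧ m 1 = inner ℝ h (C h) ∧ w 0 = h ∧ (∀ n, w n ∈ V) ∧
      ∀ ε : ℝ, |ε| < c →
        HasSum (fun n => m n * ε ^ n) (μ ε) ∧ HasSum (fun n => ε ^ n • w n) (u ε) ∧
        ‖u ε‖ = 1 ∧ inner ℝ h (μ ε • u ε - ε • C (u ε)) = 0 ∧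
        u ε = inner ℝ h (u ε) • h + S (μ ε • u ε - ε • C (u ε)) := by
  set b := ‖C‖ + 1 with hb
  have hb0 : 0 < b := by positivity
  set v := rsCoeff C S h with hv
  have hvb : ∀ k, ‖v k‖ ≤ (8 * b) ^ k := norm_rsCoeff_le (by rw [hb]; linarith) hS hh
  set U : ℝ → H := fun ε => ∑' n, ε ^ n • v n with hU
  have hc0 : 0 < 1 / (8 * b) := by positivity
  have hvn : ∀ ε : ℝ, |ε| < 1 / (8 * b) → Summable fun n => ‖ε ^ n • v n‖ := fun ε hε => by
    rw [lt_div_iff₀ (by positivity)] at hε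
    refine Summable.of_nonneg_of_le (fun _ => norm_nonneg _) (fun n => ?_)
      (summable_geometric_of_lt_one (by positivity) hε)
    rw [norm_smul, norm_pow, Real.norm_eq_abs, mul_pow]
    gcongr; exact hvb n
  have hUs : ∀ ε : ℝ, |ε| < 1 / (8 * b) → HasSum (fun n => ε ^ n • v n) (U ε) :=
    fun ε hε => (hvn ε hε).of_norm.hasSum
  have hCU : ∀ ε : ℝ, |ε| < 1 / (8 * b) → HasSum (fun n => ε ^ n • C (v n)) (C (U ε)) :=
    fun ε hε => by simpa using (hUs ε hε).mapL C
  have hmU : ∀ ε : ℝ, |ε| < 1 / (8 * b) →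
      HasSum (fun n => inner ℝ h (C (v n)) * ε ^ n) (inner ℝ h (C (U ε))) := fun ε hε => by
    simpa [inner_smul_right, mul_comm] using (hCU ε hε).mapL (innerSL ℝ h)
  have hfix : ∀ ε : ℝ, |ε| < 1 / (8 * b) →
      U ε = h + S ((ε * inner ℝ h (C (U ε))) • U ε - ε • C (U ε)) := fun ε hε => by
    have h1 := ((hasSum_pow_smul_sum_antidiagonal (hmU ε hε) (hUs ε hε) (hvn ε hε)).sub
      (hCU ε hε)).mapL S |>.const_smul ε
    have h2 : HasSum (fun n => ε ^ (n + 1) • v (n + 1))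
        (S ((ε * inner ℝ h (C (U ε))) • U ε - ε • C (U ε))) := by
      convert! h1 using 1
      · ext n
        rw [hv, rsCoeff_succ, ← smul_sub, map_smul, smul_smul, pow_succ']
      · rw [← map_smul S, smul_sub, smul_smul]
    rw [hasSum_nat_add_iff (f := fun n => ε ^ n • v n) 1] at h2
    refine ((hUs ε hε).unique h2).trans ?_
    rw [add_comm, Finset.sum_range_one, pow_zero, one_smul, hv, rsCoeff_zero]
  -- The range of `S` is orthogonal to `h`. Hence `U` never vanishes, and the solvability condition
  -- `⟨h, μ U - ε C U⟩ = 0` holds.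
  have hhU : ∀ ε : ℝ, |ε| < 1 / (8 * b) → inner ℝ h (U ε) = 1 := fun ε hε => by
    rw [hfix ε hε, inner_add_right, hSh, real_inner_self_eq_norm_sq, hh]; norm_num
  have hU0 : U 0 = h := by
    have := hUs 0 (by simpa using hb0)
    refine this.unique ?_
    convert! hasSum_ite_eq 0 h using 2 with n
    rcases n with _ | n
    · simp [hv, rsCoeff_zero]
    · simp
  have hUne : ∀ ε : ℝ, |ε| < 1 / (8 * b) → U ε ≠ 0 := fun ε hε h0 => by
    have := hhU ε hε
    rw [h0, inner_zero_right] at this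
    exact zero_ne_one this
  have hUan : AnalyticAt ℝ U 0 := analyticOnNhd_of_hasSum hc0 hUs 0 ⟨by linarith, hc0⟩
  -- The normalising factor is analytic at `0` because the squared norm is analytic and equals `1`
  -- there; its radius of convergence may shrink the interval.
  have hqan : AnalyticAt ℝ (fun ε => (√(inner ℝ (U ε) (U ε)))⁻¹) 0 := by
    have h1 : AnalyticAt ℝ (fun ε => inner ℝ (U ε) (U ε)) 0 :=
      ((innerSL ℝ (E := H)).analyticAt_bilinear (U 0, U 0)).comp₂ hUan hUan
    have h2 : inner ℝ (U 0) (U 0) = (1 : ℝ) := by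
      rw [hU0, real_inner_self_eq_norm_sq, hh]; norm_num
    have h3 : AnalyticAt ℝ (fun ε => √(inner ℝ (U ε) (U ε))) 0 :=
      (Real.contDiffAt_sqrt (n := ⊤) (by rw [h2]; norm_num)).analyticAt.fun_comp h1
    exact h3.inv (by rw [h2]; simp)
  obtain ⟨r, hr, a, ha⟩ := exists_hasSum_of_analyticAt hqan
  have hq : ∀ ε, (√(inner ℝ (U ε) (U ε)))⁻¹ = ‖U ε‖⁻¹ := fun ε => by
    rw [real_inner_self_eq_norm_sq, Real.sqrt_sq (norm_nonneg _)]
  simp only [hq] at ha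
  have ha0 : a 0 = 1 := by
    have h1 := ha 0 (by simpa using hr)
    have h2 : HasSum (fun n => a n * (0 : ℝ) ^ n) (a 0) := by
      convert! hasSum_ite_eq 0 (a 0) using 2 with n
      rcases n with _ | n <;> simp
    rw [h2.unique h1, hU0, hh, inv_one]
  -- The series of `μ` is that of `⟨h, C U⟩` shifted by one, owing to the factor `ε`. The
  -- coefficients `w` are the Cauchy product of `1/‖U‖` and `U`: finite combinations of the `v k`,
  -- hence in `V`.
  refine ⟨min (1 / (8 * b)) r, lt_min hc0 hr,
    fun n => Nat.casesOn n 0 fun k => inner ℝ h (C (v k)),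
    fun n => ∑ p ∈ Finset.HasAntidiagonal.antidiagonal n, a p.1 • v p.2,
    fun ε => ε * inner ℝ h (C (U ε)), fun ε => ‖U ε‖⁻¹ • U ε, rfl, ?_, ?_, ?_, ?_⟩
  · simp [hv, rsCoeff_zero]
  · simp [hv, rsCoeff_zero, ha0]
  · exact fun n => V.sum_mem fun p _ => V.smul_mem _ (rsCoeff_mem hV hVC hVS _)
  · intro ε hε
    have hε1 := hε.trans_le (min_le_left _ _)
    have hε2 := hε.trans_le (min_le_right _ _)
    refine ⟨?_, hasSum_pow_smul_sum_antidiagonal (ha ε hε2) (hUs ε hε1) (hvn ε hε1), ?_, ?_, ?_⟩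
    · rw [← hasSum_nat_add_iff' 1]
      convert! (hmU ε hε1).mul_left ε using 1
      · ext n
        simp only [pow_succ]; ring
      · simp
    · rw [norm_smul, norm_inv, norm_norm, inv_mul_cancel₀ (norm_ne_zero_iff.2 (hUne ε hε1))]
    · rw [map_smul, inner_sub_right, inner_smul_right, inner_smul_right, inner_smul_right,
        inner_smul_right, hhU ε hε1]
      ring
    · have e : (ε * inner ℝ h (C (U ε))) • ‖U ε‖⁻¹ • U ε - ε • C (‖U ε‖⁻¹ • U ε) =
          ‖U ε‖⁻¹ • ((ε * inner ℝ h (C (U ε))) • U ε - ε • C (U ε)) := by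
        rw [map_smul, smul_sub, smul_comm, smul_comm ε]
      rw [e, map_smul, inner_smul_right, hhU ε hε1, mul_one, ← smul_add, ← hfix ε hε1]

end RayleighSchroedinger

/-! ### Overlaps of translated Hermite functions -/

/-- Translation `f ↦ f(· - b)` on Schwartz functions. -/
def shiftS (b : ℝ) : 𝓢(ℝ, ℝ) →L[ℝ] 𝓢(ℝ, ℝ) := SchwartzMap.compSubConstCLM ℝ b

theorem shiftS_apply (b : ℝ) (f : 𝓢(ℝ, ℝ)) (x : ℝ) : shiftS b f x = f (x - b) :=
  SchwartzMap.compSubConstCLM_apply f b x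

theorem lower_shiftS (b : ℝ) (f : 𝓢(ℝ, ℝ)) :
    lower (shiftS b f) = shiftS b (lower f + (b / √2) • f) := by
  ext x
  have hd : deriv (shiftS b f) x = deriv f (x - b) := by
    have : (shiftS b f : ℝ → ℝ) = fun x => f (x - b) := funext (shiftS_apply b f)
    rw [this, deriv_comp_sub_const]
  simp only [shiftS_apply, lower_apply, smul_apply, add_apply, mulX_apply, diffS_apply, hd,
    smul_eq_mul]
  ring

theorem inner_shiftS (b : ℝ) (f g : 𝓢(ℝ, ℝ)) :
    inner ℝ (toL2 f) (toL2 (shiftS b g)) = inner ℝ (toL2 (shiftS (-b) f)) (toL2 g) := by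
  simp only [inner_toL2, shiftS_apply]
  rw [← integral_sub_right_eq_self (fun x => f (x - -b) * g x) b]
  simp

/-- Each creation operator in `φ_m` becomes an annihilation operator on the other side, and passing
it through the translation adds the scalar `b/√2`. -/
theorem inner_phiS_shiftS (b : ℝ) (m : ℕ) (f : 𝓢(ℝ, ℝ)) :
    inner ℝ (toL2 (phiS m)) (toL2 (shiftS b f)) =
      inner ℝ (toL2 (phiS 0))
        (toL2 (shiftS b (((lower + (b / √2) • 1 : 𝓢(ℝ, ℝ) →L[ℝ] 𝓢(ℝ, ℝ)) ^ m) f))) := by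
  induction m generalizing f with
  | zero => simp
  | succ m ih =>
    rw [phiS_succ, inner_raise, lower_shiftS, ih, pow_succ]
    rfl

theorem inner_phiS_zero_shiftS (b : ℝ) (n : ℕ) :
    inner ℝ (toL2 (phiS 0)) (toL2 (shiftS b (phiS n))) =
      (-(b / √2)) ^ n * inner ℝ (toL2 (phiS 0)) (toL2 (shiftS b (phiS 0))) := by
  induction n with
  | zero => simp
  | succ n ih =>
    rw [inner_shiftS, phiS_succ, ← inner_lower, lower_shiftS, lower_phiS_zero, zero_add, map_smul,
      map_smul, inner_smul_left, ← inner_shiftS, ih, conj_trivial]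
    ring

theorem lower_pow_phiS (n j : ℕ) :
    (lower ^ j) (phiS n) = (n.descFactorial j : ℝ) • phiS (n - j) := by
  induction j with
  | zero => simp
  | succ j ih =>
    rw [pow_succ', mul_apply_eq_comp, ih, map_smul, Nat.descFactorial_succ]
    rcases h : n - j with _ | k
    · rw [lower_phiS_zero]; simp
    · rw [lower_phiS_succ, smul_smul, show n - (j + 1) = k by omega]
      push_cast; ring_nf

theorem laguerre_eval (n : ℕ) (x : ℝ) :
    (laguerre n).eval x =
      ∑ j ∈ Finset.range (n + 1), (-1) ^ j * (n.choose j : ℝ) / (j.factorial : ℝ) * x ^ j := by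
  simp [laguerre, Polynomial.eval_finsetSum]

/-- The binomial expansion of `(lower + b/√2)^n` sends `φ_n` to a combination of the `φ_j`. Pairing
the translated `φ_j` with `φ_0` gives another factor `(-b/√2)^j`, and the sum is a Laguerre
polynomial at `b²/2`. -/
theorem inner_phiS_shiftS_phiS (b : ℝ) (n : ℕ) :
    inner ℝ (toL2 (phiS n)) (toL2 (shiftS b (phiS n))) =
      n.factorial * (laguerre n).eval ((b / √2) ^ 2) *
        inner ℝ (toL2 (phiS 0)) (toL2 (shiftS b (phiS 0))) := by
  have hc : Commute ((b / √2) • (1 : 𝓢(ℝ, ℝ) →L[ℝ] 𝓢(ℝ, ℝ))) lower :=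
    (Commute.one_left _).smul_left _
  rw [inner_phiS_shiftS, add_comm, hc.add_pow, sum_apply]
  simp only [map_sum, inner_sum, laguerre_eval, Finset.mul_sum, Finset.sum_mul]
  refine Finset.sum_congr rfl fun j hj => ?_
  have hj' : j ≤ n := by simpa [Nat.lt_succ_iff] using hj
  have e : ((((b / √2) • (1 : 𝓢(ℝ, ℝ) →L[ℝ] 𝓢(ℝ, ℝ))) ^ j * lower ^ (n - j) * (n.choose j))
      (phiS n)) = ((b / √2) ^ j * (n.choose j) * (n.descFactorial (n - j))) • phiS j := by
    rw [← nsmul_eq_mul', smul_apply, mul_apply_eq_comp, lower_pow_phiS, smul_pow, one_pow,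
      smul_apply, one_apply_eq_self, Nat.sub_sub_self hj', ← Nat.cast_smul_eq_nsmul ℝ, smul_smul,
      smul_smul]
    congr 1; ring
  have hf : (n.descFactorial (n - j) : ℝ) = n.factorial / j.factorial := by
    rw [eq_div_iff (by positivity)]
    have := Nat.factorial_mul_descFactorial (Nat.sub_le n j)
    rw [Nat.sub_sub_self hj'] at this
    rw [mul_comm]
    exact_mod_cast this
  rw [e, map_smul, map_smul, inner_smul_right, inner_phiS_zero_shiftS, hf, neg_pow, ← pow_mul,
    two_mul, pow_add]
  ring

theorem inner_gaussian_shiftS_pos (b : ℝ) :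
    0 < inner ℝ (toL2 (phiS 0)) (toL2 (shiftS b (phiS 0))) := by
  rw [inner_toL2]
  have hpos : ∀ x, 0 < phiS 0 x * shiftS b (phiS 0) x := fun x => by
    rw [shiftS_apply, phiS_zero, gaussian_apply, gaussian_apply]; positivity
  rw [integral_pos_iff_support_of_nonneg (fun x => (hpos x).le)
    (MemLp.integrable_mul ((phiS 0).memLp 2 volume) ((shiftS b (phiS 0)).memLp 2 volume))]
  have : (Function.support fun x => phiS 0 x * shiftS b (phiS 0) x) = Set.univ :=
    Set.eq_univ_of_forall fun x => (hpos x).ne'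
  rw [this]
  simp

theorem overlap_eq_inner (α : ℝ) (N : ℕ) :
    overlap α N = inner ℝ (toL2 (phiS N)) (toL2 (shiftS (-(2 * α)) (phiS N))) := by
  rw [overlap, inner_toL2, ← coe_phiS]
  simp only [shiftS_apply]
  rw [← integral_sub_right_eq_self (fun x => phiS N x * phiS N (x - -(2 * α))) α]
  congr 1; ext x; congr 2; ring

theorem overlap_ne_zero {α : ℝ} {N : ℕ} (h : (laguerre N).eval (2 * α ^ 2) ≠ 0) :
    overlap α N ≠ 0 := by
  have e : (-(2 * α) / √2) ^ 2 = 2 * α ^ 2 := by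
    rw [div_pow, Real.sq_sqrt (by norm_num)]; ring
  rw [overlap_eq_inner, inner_phiS_shiftS_phiS, e]
  exact mul_ne_zero (mul_ne_zero (by positivity) h) (inner_gaussian_shiftS_pos _).ne'

/-! ### Gaps between a point and the zeros of the Laguerre polynomials -/

theorem exists_isRootGapSequence {x₀ : ℝ} (h : ∀ n, (laguerre n).eval x₀ ≠ 0) :
    ∃ (k : ℕ → ℕ) (δ : ℕ → ℝ), IsRootGapSequence x₀ k δ := by
  have hd : ∀ n, ∃ d > 0, ∀ x, (laguerre n).eval x = 0 → d ≤ |x - x₀| := fun n => by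
    have := ((laguerre n).continuous.continuousAt (x := x₀)).eventually_ne (h n)
    obtain ⟨d, hd, hx⟩ := Metric.eventually_nhds_iff.1 this
    exact ⟨d, hd, fun x h0 => not_lt.1 fun hlt => hx (by rwa [Real.dist_eq]) h0⟩
  choose d hd hroot using hd
  have hne : ∀ j, (Finset.range (j + 1)).Nonempty := fun j => ⟨0, by simp⟩
  -- The cap `1/(n + 1)` forces `δ → 0`; the companion sequence is `k = id`.
  let δ : ℕ → ℝ := fun j => (Finset.range (j + 1)).inf' (hne j) fun n => min (d n) (1 / (n + 1))
  have hδ : ∀ j, 0 < δ j := fun j => by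
    rw [Finset.lt_inf'_iff]
    exact fun n _ => lt_min (hd n) (by positivity)
  have hle : ∀ {j n}, n ≤ j → δ j ≤ min (d n) (1 / (n + 1)) := fun {j n} hn =>
    Finset.inf'_le (fun n : ℕ => min (d n) (1 / ((n : ℝ) + 1)))
      (Finset.mem_range.2 (Nat.lt_succ_of_le hn))
  exact ⟨id, δ, {
    monotone_k := monotone_id
    tendsto_k := tendsto_id
    pos_δ := hδ
    antitone_δ := fun i j hij => Finset.inf'_mono _
      (Finset.range_mono (Nat.succ_le_succ hij)) (hne i)
    tendsto_δ := squeeze_zero (fun j => (hδ j).le)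
      (fun j => (hle le_rfl).trans (min_le_right _ _)) tendsto_one_div_add_atTop_nhds_zero_nat
    gap := fun j n hn x hx => (hle hn).trans ((min_le_left _ _).trans (hroot n x hx)) }⟩

/-! ### Vector valued functions -/

/-- The vector valued Schwartz function `x ↦ f x • v`. -/
def vecS (v : C2) : 𝓢(ℝ, ℝ) →L[ℝ] 𝓢(ℝ, C2) :=
  SchwartzMap.postcompCLM (ContinuousLinearMap.toSpanSingleton ℝ v)

theorem vecS_apply (v : C2) (f : 𝓢(ℝ, ℝ)) (x : ℝ) : vecS v f x = f x • v := rfl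

/-- The vector valued `L²` function `x ↦ f x • v`. -/
def vecL (v : C2) : L2R →L[ℝ] L2C2 :=
  (ContinuousLinearMap.toSpanSingleton ℝ v).compLpL 2 volume

theorem vecL_ae (v : C2) (f : L2R) : vecL v f =ᵐ[volume] fun x => f x • v :=
  ContinuousLinearMap.coeFn_compLpL _ f

theorem toLp_vecS (v : C2) (f : 𝓢(ℝ, ℝ)) : (vecS v f).toLp 2 = vecL v (toL2 f) := by
  refine Lp.ext ?_
  filter_upwards [(vecS v f).coeFn_toLp 2, vecL_ae v (toL2 f), toL2_ae f] with x h1 h2 h3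
  rw [h1, h2, h3, vecS_apply]

theorem deriv_vecS (v : C2) (f : 𝓢(ℝ, ℝ)) : deriv (vecS v f) = vecS v (diffS f) := by
  ext1 x
  have h : HasDerivAt (vecS v f) (deriv f x • v) x := (f.hasDerivAt x).smul_const v
  rw [h.deriv, vecS_apply, diffS_apply]

theorem oscSchwartz_vecS (v : C2) (f : 𝓢(ℝ, ℝ)) : oscSchwartz (vecS v f) = vecS v (osc f) := by
  ext1 x
  rw [oscSchwartz_apply, deriv_vecS, deriv_vecS, vecS_apply, vecS_apply, vecS_apply, osc_apply,
    smul_apply, sub_apply, mulX_apply, mulX_apply, smul_eq_mul, smul_smul, ← sub_smul, smul_smul]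
  congr 1; ring

/-! ### The graph of the oscillator -/

/-- The inner product of `ℂ²` as a real bilinear map. -/
def innerC2 : C2 →L[ℝ] C2 →L[ℝ] ℂ :=
  LinearMap.mkContinuous₂
    (LinearMap.mk₂ ℝ (fun x y : C2 => inner ℂ x y) (fun x y z => inner_add_left x y z)
      (fun c x y => by
        rw [RCLike.real_smul_eq_coe_smul (K := ℂ), inner_smul_left]; simp)
      (fun x y z => inner_add_right x y z)
      (fun c x y => by
        rw [RCLike.real_smul_eq_coe_smul (K := ℂ), inner_smul_right]; simp)) 1
    fun x y => by rw [one_mul]; exact norm_inner_le_norm x y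

theorem inner_derivCLM (f g : 𝓢(ℝ, C2)) :
    inner ℂ (f.toLp 2) ((SchwartzMap.derivCLM ℝ C2 g).toLp 2) =
      -inner ℂ ((SchwartzMap.derivCLM ℝ C2 f).toLp 2) (g.toLp 2) := by
  rw [SchwartzMap.inner_toL2_toL2_eq _ _ volume, SchwartzMap.inner_toL2_toL2_eq _ _ volume]
  exact SchwartzMap.integral_bilinear_deriv_right_eq_neg_left f g innerC2

theorem inner_smulLeftCLM (f g : 𝓢(ℝ, C2)) :
    inner ℂ (f.toLp 2) ((SchwartzMap.smulLeftCLM C2 (fun x : ℝ => x ^ 2) g).toLp 2) =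
      inner ℂ ((SchwartzMap.smulLeftCLM C2 (fun x : ℝ => x ^ 2) f).toLp 2) (g.toLp 2) := by
  rw [SchwartzMap.inner_toL2_toL2_eq _ _ volume, SchwartzMap.inner_toL2_toL2_eq _ _ volume]
  congr 1; ext x
  have hx : Function.HasTemperateGrowth (fun x : ℝ => x ^ 2) := by fun_prop
  rw [SchwartzMap.smulLeftCLM_apply_apply hx, SchwartzMap.smulLeftCLM_apply_apply hx,
    RCLike.real_smul_eq_coe_smul (K := ℂ), RCLike.real_smul_eq_coe_smul (K := ℂ), inner_smul_left,
    inner_smul_right]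
  simp

theorem toLp_real_smul (c : ℝ) (f : 𝓢(ℝ, C2)) :
    ((c • f).toLp 2 : L2C2) = (c : ℂ) • f.toLp 2 volume := by
  change SchwartzMap.toLpCLM ℝ C2 2 volume (c • f) = _
  rw [map_smul, RCLike.real_smul_eq_coe_smul (K := ℂ)]
  rfl

theorem toLp_oscSchwartz (f : 𝓢(ℝ, C2)) :
    (oscSchwartz f).toLp 2 = ((1 / 2 : ℝ) : ℂ) •
      ((SchwartzMap.smulLeftCLM C2 (fun x : ℝ => x ^ 2) f).toLp 2 volume -
        (SchwartzMap.derivCLM ℝ C2 (SchwartzMap.derivCLM ℝ C2 f)).toLp 2 volume : L2C2) := by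
  change SchwartzMap.toLpCLM ℝ C2 2 volume ((1 / 2 : ℝ) •
    (SchwartzMap.smulLeftCLM C2 (fun x : ℝ => x ^ 2) f -
      SchwartzMap.derivCLM ℝ C2 (SchwartzMap.derivCLM ℝ C2 f))) = _
  rw [map_smul, map_sub, RCLike.real_smul_eq_coe_smul (K := ℂ)]
  rfl

theorem toLp_mem_oscGraph (g : 𝓢(ℝ, C2)) :
    ((g.toLp 2 : L2C2), ((oscSchwartz g).toLp 2 : L2C2)) ∈ oscGraph := by
  intro f
  simp only [toLp_oscSchwartz]
  rw [inner_smul_left, inner_smul_right, inner_sub_left, inner_sub_right, inner_smulLeftCLM,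
    inner_derivCLM, inner_derivCLM, neg_neg, Complex.conj_ofReal]

theorem vecL_herm_mem_oscGraph (v : C2) (M : ℕ) :
    (vecL v (herm M), ((M : ℝ) + 1 / 2) • vecL v (herm M)) ∈ oscGraph := by
  have := toLp_mem_oscGraph (vecS v (hermS M))
  rw [oscSchwartz_vecS, osc_hermS, toLp_vecS, toLp_vecS, map_smul, map_smul, ← herm_apply] at this
  exact this

theorem mem_domain_of_mem_oscGraph {u g : L2C2} (h : (u, g) ∈ oscGraph) :
    ∃ hu : u ∈ opA.domain, opA ⟨u, hu⟩ = g := by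
  rw [← opA_graph, LinearPMap.mem_graph_iff] at h
  obtain ⟨y, rfl, h2⟩ := h
  exact ⟨y.2, h2⟩

theorem mem_eigenspace_opA {z : ℂ} {u : L2C2} : u ∈ eigenspace opA z ↔ (u, z • u) ∈ oscGraph := by
  constructor
  · rintro ⟨y, hy, rfl⟩
    rw [← opA_graph, LinearPMap.mem_graph_iff]
    refine ⟨y, rfl, ?_⟩
    exact sub_eq_zero.1 hy
  · intro h
    obtain ⟨hu, h2⟩ := mem_domain_of_mem_oscGraph h
    exact ⟨⟨u, hu⟩, sub_eq_zero.2 h2, rfl⟩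

theorem isEigenEq_opAB {α γ₁ γ₂ ε lam : ℝ} {u : L2C2}
    (h : (u, lam • u - ε • opB α γ₁ γ₂ u) ∈ oscGraph) :
    IsEigenEq (opAB α γ₁ γ₂ ε) (lam : ℂ) u := by
  obtain ⟨hu, h2⟩ := mem_domain_of_mem_oscGraph h
  refine ⟨hu, ?_⟩
  change opA ⟨u, hu⟩ + (ε : ℂ) • opB α γ₁ γ₂ u = _
  rw [h2, RCLike.real_smul_eq_coe_smul (K := ℂ), RCLike.real_smul_eq_coe_smul (K := ℂ) ε]
  exact sub_add_cancel _ _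

/-! ### The eigenspaces of the oscillator -/

theorem inner_vecS_single (i : Fin 2) (f : 𝓢(ℝ, ℝ)) (u : L2C2) :
    inner ℂ ((vecS (EuclideanSpace.single i 1) f).toLp 2) u = ∫ x, (f x : ℂ) * u x i := by
  rw [L2.inner_def]
  refine integral_congr_ae ?_
  filter_upwards [(vecS (EuclideanSpace.single i (1 : ℂ)) f).coeFn_toLp 2] with x h1
  rw [h1, vecS_apply, RCLike.real_smul_eq_coe_smul (K := ℂ), inner_smul_left,
    EuclideanSpace.inner_single_left]
  simp

theorem eq_zero_of_inner_vecS_hermS_eq_zero {u : L2C2}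
    (h : ∀ i M, inner ℂ ((vecS (EuclideanSpace.single i 1) (hermS M)).toLp 2) u = 0) : u = 0 := by
  have hi : ∀ i : Fin 2, (fun x => u x i) =ᵐ[volume] 0 := fun i => by
    have hm : MemLp (fun x => u x i) 2 :=
      (Lp.memLp (component i u)).ae_eq (ContinuousLinearMap.coeFn_compLpL _ u)
    refine ae_eq_zero_of_integral_phi_mul_eq_zero hm fun M => ?_
    have h1 := h i M
    rw [inner_vecS_single] at h1
    have e : ∀ x, (hermS M x : ℂ) * u x i = (√(phiNormSq M) : ℂ)⁻¹ * ((phi M x : ℂ) * u x i) :=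
      fun x => by rw [hermS_apply]; push_cast; ring
    simp only [e] at h1
    rw [integral_const_mul] at h1
    have hp := phiNormSq_pos M
    refine (mul_eq_zero.1 h1).resolve_left (inv_ne_zero ?_)
    exact_mod_cast (Real.sqrt_pos.2 hp).ne'
  rw [Lp.eq_zero_iff_ae_eq_zero]
  filter_upwards [hi 0, hi 1] with x h0 h1
  ext i
  fin_cases i
  · exact h0
  · exact h1

/-- `v ↦ h_N ⊗ v`. -/
def eigenvectorMap (N : ℕ) : C2 →ₗ[ℂ] L2C2 where
  toFun v := SchwartzMap.toLpCLM ℂ C2 2 volume (vecS v (hermS N))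
  map_add' v w := by
    rw [← map_add]; congr 1; ext1 x
    rw [add_apply, vecS_apply, vecS_apply, vecS_apply, smul_add]
  map_smul' c v := by
    rw [RingHom.id_apply, ← map_smul]; congr 1; ext1 x
    rw [smul_apply, vecS_apply, vecS_apply, smul_comm]

theorem eigenvectorMap_apply (N : ℕ) (v : C2) : eigenvectorMap N v = vecL v (herm N) := by
  rw [herm_apply, ← toLp_vecS]; rfl

theorem inner_eigenvectorMap (i : Fin 2) (M N : ℕ) (v : C2) :
    inner ℂ ((vecS (EuclideanSpace.single i 1) (hermS M)).toLp 2) (eigenvectorMap N v) =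
      if M = N then v i else 0 := by
  have h := orthonormal_iff_ite.1 orthonormal_hermS M N
  rw [inner_toL2] at h
  have e : ∀ x, inner ℂ (vecS (EuclideanSpace.single i (1 : ℂ)) (hermS M) x)
      (vecS v (hermS N) x) = ((hermS M x * hermS N x : ℝ) : ℂ) * v i := fun x => by
    rw [vecS_apply, vecS_apply, RCLike.real_smul_eq_coe_smul (K := ℂ), inner_smul_left,
      RCLike.real_smul_eq_coe_smul (K := ℂ), inner_smul_right, EuclideanSpace.inner_single_left]
    simp; ring
  refine (SchwartzMap.inner_toL2_toL2_eq _ _ volume).trans ?_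
  simp only [e]
  rw [integral_mul_const, integral_complex_ofReal, h]
  split_ifs <;> simp

theorem eigenvectorMap_injective (N : ℕ) : Function.Injective (eigenvectorMap N) := by
  rw [injective_iff_map_eq_zero]
  intro v hv
  ext i
  have := inner_eigenvectorMap i N N v
  rw [hv, inner_zero_right, if_pos rfl] at this
  exact this.symm

/-- Testing the distributional equation against `h_M ⊗ e_i` gives `(N - M) c = 0` for the
corresponding coefficient `c` of `u`, so only `M = N` survives; completeness does the rest. -/
theorem range_eigenvectorMap (N : ℕ) :
    LinearMap.range (eigenvectorMap N) = eigenspace opA ((N : ℂ) + 1 / 2) := by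
  ext u
  rw [mem_eigenspace_opA]
  constructor
  · rintro ⟨v, rfl⟩
    have := vecL_herm_mem_oscGraph v N
    rw [RCLike.real_smul_eq_coe_smul (K := ℂ)] at this
    rw [eigenvectorMap_apply]
    convert! this using 3
    simp
  · intro h
    have h0 : ∀ i M, M ≠ N →
        inner ℂ ((vecS (EuclideanSpace.single i 1) (hermS M)).toLp 2) u = 0 := fun i M hM => by
      have h1 := h (vecS (EuclideanSpace.single i 1) (hermS M))
      simp only at h1
      rw [oscSchwartz_vecS, osc_hermS, map_smul, toLp_real_smul, inner_smul_left,
        inner_smul_right] at h1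
      have h2 : ((N : ℂ) - M) *
          inner ℂ ((vecS (EuclideanSpace.single i 1) (hermS M)).toLp 2) u = 0 := by
        simp only [Complex.conj_ofReal] at h1
        push_cast at h1
        linear_combination h1
      exact (mul_eq_zero.1 h2).resolve_left
        (sub_ne_zero.2 (by exact_mod_cast hM.symm))
    let v : C2 := WithLp.toLp 2 fun i =>
      inner ℂ ((vecS (EuclideanSpace.single i 1) (hermS N)).toLp 2) u
    refine ⟨v, ?_⟩
    rw [← sub_eq_zero]
    refine eq_zero_of_inner_vecS_hermS_eq_zero fun i M => ?_
    rw [inner_sub_right, inner_eigenvectorMap]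
    split_ifs with hM
    · subst hM; exact sub_self _
    · rw [h0 i M hM, sub_zero]

theorem finrank_eigenspace_opA (N : ℕ) :
    Module.finrank ℂ (eigenspace opA ((N : ℂ) + 1 / 2)) = 2 := by
  rw [← range_eigenvectorMap, LinearMap.finrank_range_of_inj (eigenvectorMap_injective N)]
  simp

/-! ### The symmetry sectors -/

/-- The reflection `f ↦ f(c - ·)` on `L²(ℝ)`. -/
def reflL (c : ℝ) : L2R →ₗᵢ[ℝ] L2R :=
  Lp.compMeasurePreservingₗᵢ ℝ (fun x : ℝ => c - x) (volume.measurePreserving_sub_left c)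

theorem reflL_ae (c : ℝ) (f : L2R) : reflL c f =ᵐ[volume] fun x => f (c - x) :=
  Lp.coeFn_compMeasurePreserving f (volume.measurePreserving_sub_left c)

/-- The reflection `f ↦ f(c - ·)` on Schwartz functions. -/
def reflS (c : ℝ) : 𝓢(ℝ, ℝ) →L[ℝ] 𝓢(ℝ, ℝ) :=
  shiftS c ∘L SchwartzMap.compCLMOfContinuousLinearEquiv ℝ (ContinuousLinearEquiv.neg ℝ)

theorem reflS_apply (c : ℝ) (f : 𝓢(ℝ, ℝ)) (x : ℝ) : reflS c f x = f (c - x) := by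
  refine (shiftS_apply _ _ _).trans ?_
  change f (-(x - c)) = _
  rw [neg_sub]

theorem reflL_toL2 (c : ℝ) (f : 𝓢(ℝ, ℝ)) : reflL c (toL2 f) = toL2 (reflS c f) := by
  refine Lp.ext ?_
  filter_upwards [reflL_ae c (toL2 f), toL2_ae (reflS c f),
    (volume.measurePreserving_sub_left c).quasiMeasurePreserving.ae_eq_comp (toL2_ae f)]
    with x h1 h2 h3
  rw [h1, h2, reflS_apply]
  exact h3

/-- The embedding `f ↦ (a f, b f(-·))` of `L²(ℝ)` into `L²(ℝ; ℂ²)`. -/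
def sectorL (a b : ℝ) : L2R →L[ℝ] L2C2 :=
  vecL (EuclideanSpace.single 0 (a : ℂ)) +
    vecL (EuclideanSpace.single 1 (b : ℂ)) ∘L (reflL 0).toContinuousLinearMap

/-- The embedding `f ↦ (a f, b f(-·))` on Schwartz functions. -/
def sectorS (a b : ℝ) : 𝓢(ℝ, ℝ) →L[ℝ] 𝓢(ℝ, C2) :=
  vecS (EuclideanSpace.single 0 (a : ℂ)) + vecS (EuclideanSpace.single 1 (b : ℂ)) ∘L reflS 0

theorem sectorL_ae (a b : ℝ) (f : L2R) :
    sectorL a b f =ᵐ[volume] fun x => !₂[((a * f x : ℝ) : ℂ), ((b * f (-x) : ℝ) : ℂ)] := by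
  have h : sectorL a b f = vecL (EuclideanSpace.single 0 (a : ℂ)) f +
    vecL (EuclideanSpace.single 1 (b : ℂ)) (reflL 0 f) := rfl
  rw [h]
  filter_upwards [Lp.coeFn_add (vecL (EuclideanSpace.single 0 (a : ℂ)) f)
    (vecL (EuclideanSpace.single 1 (b : ℂ)) (reflL 0 f)),
    vecL_ae (EuclideanSpace.single 0 (a : ℂ)) f,
    vecL_ae (EuclideanSpace.single 1 (b : ℂ)) (reflL 0 f), reflL_ae 0 f] with x h1 h2 h3 h4
  rw [h1, Pi.add_apply, h2, h3, h4, zero_sub]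
  ext i
  fin_cases i <;> simp [mul_comm]

theorem sectorS_apply (a b : ℝ) (f : 𝓢(ℝ, ℝ)) (x : ℝ) :
    sectorS a b f x = !₂[((a * f x : ℝ) : ℂ), ((b * f (-x) : ℝ) : ℂ)] := by
  have h : sectorS a b f x = vecS (EuclideanSpace.single 0 (a : ℂ)) f x +
    vecS (EuclideanSpace.single 1 (b : ℂ)) (reflS 0 f) x := rfl
  rw [h, vecS_apply, vecS_apply, reflS_apply, zero_sub]
  ext i
  fin_cases i <;> simp [mul_comm]

theorem toLp_sectorS (a b : ℝ) (f : 𝓢(ℝ, ℝ)) : (sectorS a b f).toLp 2 = sectorL a b (toL2 f) := by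
  change SchwartzMap.toLpCLM ℝ C2 2 volume (vecS (EuclideanSpace.single 0 (a : ℂ)) f +
    vecS (EuclideanSpace.single 1 (b : ℂ)) (reflS 0 f)) = _
  rw [map_add]
  change (vecS _ f).toLp 2 volume + (vecS _ (reflS 0 f)).toLp 2 volume = _
  rw [toLp_vecS, toLp_vecS, ← reflL_toL2]
  rfl

/-- Besides isometry, this shows that inner products within the real sector are real, which is the
phase condition. -/
theorem inner_sectorL {a b : ℝ} (hab : a ^ 2 + b ^ 2 = 1) (f g : L2R) :
    inner ℂ (sectorL a b f) (sectorL a b g) = ((inner ℝ f g : ℝ) : ℂ) := by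
  have hi : Integrable fun x => f x * g x := MemLp.integrable_mul (Lp.memLp f) (Lp.memLp g)
  have e : inner ℝ f g = ∫ x, (a ^ 2 * (f x * g x) + b ^ 2 * (f (-x) * g (-x))) := by
    rw [integral_add (hi.const_mul _) (hi.comp_neg.const_mul _), integral_const_mul,
      integral_const_mul, integral_neg_eq_self (fun x => f x * g x), ← add_mul, hab, one_mul,
      L2.inner_def]
    simp [mul_comm]
  rw [e, L2.inner_def, ← integral_complex_ofReal]
  refine integral_congr_ae ?_
  filter_upwards [sectorL_ae a b f, sectorL_ae a b g] with x h1 h2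
  rw [h1, h2]
  simp [PiLp.inner_apply, Fin.sum_univ_two]
  ring

theorem norm_sectorL {a b : ℝ} (hab : a ^ 2 + b ^ 2 = 1) (f : L2R) : ‖sectorL a b f‖ = ‖f‖ := by
  have h := inner_sectorL hab f f
  rw [inner_self_eq_norm_sq_to_K, real_inner_self_eq_norm_sq] at h
  have h2 : ‖sectorL a b f‖ ^ 2 = ‖f‖ ^ 2 := by
    have : ((‖sectorL a b f‖ ^ 2 : ℝ) : ℂ) = ((‖f‖ ^ 2 : ℝ) : ℂ) := by
      rw [← h]; push_cast; rfl
    exact_mod_cast this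
  exact (sq_eq_sq₀ (norm_nonneg _) (norm_nonneg _)).1 h2

theorem sectorS_hermS (a b : ℝ) (M : ℕ) :
    sectorS a b (hermS M) = vecS !₂[(a : ℂ), ((b * (-1) ^ M : ℝ) : ℂ)] (hermS M) := by
  ext1 x
  rw [sectorS_apply, hermS_neg, vecS_apply]
  ext i
  fin_cases i
  · simp [mul_comm]
  · simp; ring

theorem sectorL_herm_mem_oscGraph (a b : ℝ) (M : ℕ) :
    (sectorL a b (herm M), ((M : ℝ) + 1 / 2) • sectorL a b (herm M)) ∈ oscGraph := by
  have : sectorL a b (herm M) = vecL !₂[(a : ℂ), ((b * (-1) ^ M : ℝ) : ℂ)] (herm M) := by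
    rw [herm_apply, ← toLp_sectorS, sectorS_hermS, toLp_vecS]
  rw [this]
  exact vecL_herm_mem_oscGraph _ M

theorem smul_mem_oscGraph {p : L2C2 × L2C2} (hp : p ∈ oscGraph) (c : ℝ) : c • p ∈ oscGraph := by
  have : c • p = (c : ℂ) • p := by
    ext1
    · exact RCLike.real_smul_eq_coe_smul (K := ℂ) c p.1
    · exact RCLike.real_smul_eq_coe_smul (K := ℂ) c p.2
  rw [this]
  exact oscGraph.smul_mem _ hp

theorem isClosed_oscGraph : IsClosed (oscGraph : Set (L2C2 × L2C2)) := by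
  have : (oscGraph : Set (L2C2 × L2C2)) = ⋂ ψ : 𝓢(ℝ, C2),
      {p | inner ℂ (ψ.toLp 2 volume) p.2 = inner ℂ ((oscSchwartz ψ).toLp 2 volume) p.1} := by
    ext p; simp only [Set.mem_iInter]; rfl
  rw [this]
  exact isClosed_iInter fun ψ => isClosed_eq (by fun_prop) (by fun_prop)

/-- This is `(A - N - 1/2) S = 1 - P` with `P` the projection onto `h_N`. It is checked on the
Hermite basis and extends by density because the graph is closed. -/
theorem sectorL_resolvent_mem_oscGraph (a b : ℝ) (N : ℕ) (f : L2R) :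
    (sectorL a b (resolvent N f), ((N : ℝ) + 1 / 2) • sectorL a b (resolvent N f) +
      sectorL a b (f - inner ℝ (herm N) f • herm N)) ∈ oscGraph := by
  let T : L2R →L[ℝ] L2C2 × L2C2 := (sectorL a b ∘L resolvent N).prod
    (((N : ℝ) + 1 / 2) • (sectorL a b ∘L resolvent N) +
      sectorL a b ∘L (.id ℝ L2R - (innerSL ℝ (herm N)).smulRight (herm N)))
  have hT : ∀ M, T (herm M) ∈ oscGraph.restrictScalars ℝ := fun M => by
    change (sectorL a b (resolvent N (herm M)), ((N : ℝ) + 1 / 2) •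
      sectorL a b (resolvent N (herm M)) +
      sectorL a b (herm M - inner ℝ (herm N) (herm M) • herm N)) ∈ oscGraph
    rw [resolvent_herm, orthonormal_iff_ite.1 herm.orthonormal]
    by_cases h : N = M
    · subst h
      simp only [sub_self, inv_zero, zero_smul, map_zero, smul_zero, if_true, one_smul, add_zero]
      exact oscGraph.zero_mem
    · have h1 : (M : ℝ) - N ≠ 0 := sub_ne_zero.2 (by exact_mod_cast Ne.symm h)
      convert! smul_mem_oscGraph (sectorL_herm_mem_oscGraph a b M) (((M : ℝ) - N)⁻¹) using 1
      rw [if_neg h, zero_smul, sub_zero, map_smul, Prod.smul_mk, smul_smul, smul_smul]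
      congr 1
      nth_rewrite 2 [← one_smul ℝ (sectorL a b (herm M))]
      rw [← add_smul]
      congr 1
      field_simp
      ring
  have hcl : IsClosed (T ⁻¹' oscGraph) := isClosed_oscGraph.preimage T.continuous
  have hspan : Submodule.span ℝ (Set.range herm) ≤
      (oscGraph.restrictScalars ℝ).comap (T : L2R →ₗ[ℝ] L2C2 × L2C2) :=
    Submodule.span_le.2 (by rintro _ ⟨M, rfl⟩; exact hT M)
  have hd : f ∈ (Submodule.span ℝ (Set.range herm)).topologicalClosure := by
    rw [herm.dense_span]; trivial
  exact closure_minimal (t := T ⁻¹' oscGraph) hspan hcl hd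

/-- The operator to which `opB` reduces on a symmetry sector. -/
def sectorB (α γ₁ γ₂ κ : ℝ) : L2R →L[ℝ] L2R :=
  beta₁ γ₁ γ₂ • .id ℝ L2R + (beta₂ γ₁ γ₂ * κ) • (reflL (2 * α)).toContinuousLinearMap

theorem sectorB_apply (α γ₁ γ₂ κ : ℝ) (f : L2R) :
    sectorB α γ₁ γ₂ κ f = beta₁ γ₁ γ₂ • f + (beta₂ γ₁ γ₂ * κ) • reflL (2 * α) f := rfl

theorem sectorB_ae (α γ₁ γ₂ κ : ℝ) (f : L2R) : sectorB α γ₁ γ₂ κ f =ᵐ[volume]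
    fun x => beta₁ γ₁ γ₂ * f x + beta₂ γ₁ γ₂ * κ * f (2 * α - x) := by
  rw [sectorB_apply]
  filter_upwards [Lp.coeFn_add (beta₁ γ₁ γ₂ • f) ((beta₂ γ₁ γ₂ * κ) • reflL (2 * α) f),
    Lp.coeFn_smul (beta₁ γ₁ γ₂) f, Lp.coeFn_smul (beta₂ γ₁ γ₂ * κ) (reflL (2 * α) f),
    reflL_ae (2 * α) f] with x h1 h2 h3 h4
  rw [h1, Pi.add_apply, h2, h3, Pi.smul_apply, Pi.smul_apply, h4, smul_eq_mul, smul_eq_mul]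

theorem sectorB_mem_schwartzL2 (α γ₁ γ₂ κ : ℝ) {f : L2R} (hf : f ∈ schwartzL2) :
    sectorB α γ₁ γ₂ κ f ∈ schwartzL2 := by
  obtain ⟨g, rfl⟩ := hf
  rw [sectorB_apply]
  refine add_mem (Submodule.smul_mem _ _ ⟨g, rfl⟩) (Submodule.smul_mem _ _ ⟨reflS (2 * α) g, ?_⟩)
  exact (reflL_toL2 _ _).symm

/-- Translation by `±2α` combined with `x ↦ -x` is a reflection. The relations between `a`, `b` and
`κ` make the two components give the same scalar operator. -/
theorem opB_sectorL (α γ₁ γ₂ : ℝ) {a b κ : ℝ} (h1 : a * κ = b) (h2 : b * κ = a) (f : L2R) :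
    opB α γ₁ γ₂ (sectorL a b f) = sectorL a b (sectorB α γ₁ γ₂ κ f) := by
  refine Lp.ext ?_
  have hJ := sectorL_ae a b f
  have hm := (measurePreserving_sub_right (volume : Measure ℝ) α).comp
    (measurePreserving_sub_right volume α)
  have hp := (measurePreserving_add_right (volume : Measure ℝ) α).comp
    (measurePreserving_add_right volume α)
  filter_upwards [opB_ae α γ₁ γ₂ (sectorL a b f), sectorL_ae a b (sectorB α γ₁ γ₂ κ f), hJ,
    hm.quasiMeasurePreserving.ae_eq_comp hJ, hp.quasiMeasurePreserving.ae_eq_comp hJ,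
    sectorB_ae α γ₁ γ₂ κ f,
    (Measure.measurePreserving_neg volume).quasiMeasurePreserving.ae_eq_comp
      (sectorB_ae α γ₁ γ₂ κ f)] with x e1 e2 e3 e4 e5 e6 e7
  simp only [Function.comp_apply] at e4 e5 e7
  rw [e1, e2, e3, e4, e5, e6, e7]
  rw [show -(x - α - α) = 2 * α - x by ring, show x + α + α = 2 * α - -x by ring]
  ext i
  fin_cases i
  · simp [← h1]; ring
  · simp [← h2]; ring

/-! ### The perturbed eigenvalues -/

theorem overlap_eq_integral_reflection (α : ℝ) (N : ℕ) :
    overlap α N = (-1) ^ N * ∫ x, phi N x * phi N (2 * α - x) := by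
  rw [overlap, ← integral_const_mul,
    ← integral_sub_right_eq_self (fun x => phi N (x - α) * phi N (x + α)) α]
  congr 1; ext x
  rw [show x - α - α = -(2 * α - x) by ring, phi_neg, sub_add_cancel]
  ring

/-- Parity of `φ_N` turns the reflection about `α` into a translation, at the price of `(-1)^N`. -/
theorem inner_herm_reflL (α : ℝ) (N : ℕ) :
    inner ℝ (herm N) (reflL (2 * α) (herm N)) = (-1) ^ N * overlap α N / phiNormSq N := by
  have hp := phiNormSq_pos N
  have hs : √(phiNormSq N) * √(phiNormSq N) = phiNormSq N := Real.mul_self_sqrt hp.le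
  rw [herm_apply, reflL_toL2, inner_toL2, overlap_eq_integral_reflection, ← mul_assoc, ← mul_pow]
  norm_num
  rw [← integral_div]
  congr 1; ext x
  rw [reflS_apply, hermS_apply, hermS_apply, div_mul_div_comm, hs]

theorem sign_mul_self (o : ℝ) : Real.sign o * o = |o| := by
  rcases lt_trichotomy o 0 with h | h | h
  · rw [Real.sign_of_neg h, abs_of_neg h]; ring
  · simp [h]
  · rw [Real.sign_of_pos h, abs_of_pos h, one_mul]

theorem sign_sq {o : ℝ} (h : o ≠ 0) : Real.sign o ^ 2 = 1 := by
  rcases Real.sign_apply_eq_of_ne_zero o h with h | h <;> rw [h] <;> norm_num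

theorem unit_cast_sq (s : ℤˣ) : (((s : ℤ) : ℝ)) ^ 2 = 1 := by
  rcases Int.units_eq_one_or s with rfl | rfl <;> norm_num

theorem sectorS_hermS_eq_phiPM (α : ℝ) (N : ℕ) (s : ℤˣ) (x : ℝ) :
    sectorS (Real.sign (overlap α N) / √2) (((s : ℤ) : ℝ) * (-1) ^ N / √2) (hermS N) x =
      phiPM α N s x := by
  have h : ((-1 : ℂ) ^ N) * (-1) ^ N = 1 := by rw [← mul_pow]; norm_num
  rw [sectorS_hermS, vecS_apply, phiPM, hermS_apply, RCLike.real_smul_eq_coe_smul (K := ℂ)]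
  congr 1
  ext i
  fin_cases i
  · simp
  · simp only [Fin.mk_one, Matrix.cons_val_one, Matrix.cons_val_fin_one]
    push_cast
    linear_combination ((s : ℤ) : ℂ) / (√2 : ℂ) * h

theorem exists_perturbed_eigenpair (α γ₁ γ₂ : ℝ) (N : ℕ) (ho : overlap α N ≠ 0) (s : ℤˣ) :
    ∃ c > 0, ∃ (lam : ℝ → ℝ) (lamCoeff : ℕ → ℝ) (u : ℝ → L2C2) (uCoeff : ℕ → 𝓢(ℝ, C2)),
      lamCoeff 0 = N + 1 / 2 ∧ lamCoeff 1 = mu α γ₁ γ₂ N s ∧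
      (∀ x : ℝ, uCoeff 0 x = phiPM α N s x) ∧
      (∀ n, (inner ℂ ((uCoeff 0).toLp 2 : L2C2) ((uCoeff n).toLp 2)).im = 0) ∧
      ∀ ε : ℝ, |ε| < c →
        HasSum (fun n => lamCoeff n * ε ^ n) (lam ε) ∧
        HasSum (fun n => ε ^ n • (uCoeff n).toLp 2) (u ε) ∧
        ‖u ε‖ = 1 ∧ IsEigenEq (opAB α γ₁ γ₂ ε) (lam ε : ℂ) (u ε) := by
  set σ := Real.sign (overlap α N) with hσ
  -- The factor `(-1)^N` undoes the parity of `h_N`: the second component at `ε = 0` becomes `s h_N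
  -- / √2`. The sector is the one with `κ = σ τ`.
  set τ : ℝ := ((s : ℤ) : ℝ) * (-1) ^ N with hτ
  have hσ2 : σ ^ 2 = 1 := sign_sq ho
  have hτ2 : τ ^ 2 = 1 := by
    rw [hτ, mul_pow, unit_cast_sq, ← pow_mul, mul_comm N, pow_mul]; norm_num
  have h2 : (√2 : ℝ) ^ 2 = 2 := Real.sq_sqrt (by norm_num)
  have hab : (σ / √2) ^ 2 + (τ / √2) ^ 2 = 1 := by
    rw [div_pow, div_pow, hσ2, hτ2, h2]; norm_num
  have hκ1 : σ / √2 * (σ * τ) = τ / √2 := by linear_combination τ / √2 * hσ2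
  have hκ2 : τ / √2 * (σ * τ) = σ / √2 := by linear_combination σ / √2 * hτ2
  obtain ⟨c, hc, m, w, μ, v, hm0, hm1, hw0, hwV, hε⟩ := exists_perturbed_eigenvector
    (C := sectorB α γ₁ γ₂ (σ * τ)) (norm_resolvent_le N) (herm.orthonormal.1 N)
    (fun f => by rw [inner_herm_resolvent]; simp)
    (V := schwartzL2) ⟨hermS N, (herm_apply N).symm⟩
    (fun f hf => sectorB_mem_schwartzL2 _ _ _ _ hf) (fun f hf => resolvent_mem_schwartzL2 N hf)
  choose g hg using hwV
  replace hg : ∀ n, toL2 (g n) = w n := hg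
  have hg0 : g 0 = hermS N := toL2_injective (by rw [hg, hw0, herm_apply])
  set J := sectorL (σ / √2) (τ / √2) with hJ
  have hgJ : ∀ n, ((sectorS (σ / √2) (τ / √2) (g n)).toLp 2 : L2C2) = J (w n) := fun n => by
    rw [toLp_sectorS, hg]
  refine ⟨c, hc, fun ε => N + 1 / 2 + μ ε, fun n => if n = 0 then N + 1 / 2 else m n,
    fun ε => J (v ε), fun n => sectorS (σ / √2) (τ / √2) (g n), by simp, ?_, ?_, ?_, ?_⟩
  · have hi : inner ℝ (herm N) (herm N) = (1 : ℝ) := by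
      rw [real_inner_self_eq_norm_sq, herm.orthonormal.1 N]; norm_num
    have hN : ((-1 : ℝ) ^ N) * (-1) ^ N = 1 := by rw [← mul_pow]; norm_num
    beta_reduce
    rw [if_neg one_ne_zero, hm1, sectorB_apply, inner_add_right, inner_smul_right,
      inner_smul_right, inner_herm_reflL, hi, mu, ← sign_mul_self, ← hσ, hτ]
    linear_combination beta₂ γ₁ γ₂ * σ * ((s : ℤ) : ℝ) * overlap α N / phiNormSq N * hN
  · intro x
    beta_reduce
    rw [hg0]
    exact sectorS_hermS_eq_phiPM α N s x
  · intro n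
    rw [hgJ, hgJ, hJ, inner_sectorL hab, Complex.ofReal_im]
  · intro ε hlt
    obtain ⟨h1, h2, h3, h4, h5⟩ := hε ε hlt
    refine ⟨?_, ?_, ?_, isEigenEq_opAB ?_⟩
    · have := (hasSum_ite_eq 0 ((N : ℝ) + 1 / 2)).add h1
      refine this.congr_fun fun n => ?_
      split_ifs with hn
      · subst hn; simp [hm0]
      · simp [hn]
    · simp only [hgJ]
      simpa using h2.mapL J
    · rw [hJ, norm_sectorL hab, h3]
    · set f := μ ε • v ε - ε • sectorB α γ₁ γ₂ (σ * τ) (v ε) with hf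
      -- The graph elements over `⟨h, v⟩ J h` and `J S f` are added. By the fixed-point identity the
      -- first entries sum to `J v`; by `h4` the projection term vanishes.
      have key := oscGraph.add_mem
        (smul_mem_oscGraph (sectorL_herm_mem_oscGraph (σ / √2) (τ / √2) N)
          (inner ℝ (herm N) (v ε)))
        (sectorL_resolvent_mem_oscGraph (σ / √2) (τ / √2) N f)
      rw [h4, zero_smul, sub_zero, ← hJ, Prod.smul_mk, Prod.mk_add_mk, ← map_smul, ← map_add,
        ← h5, smul_comm, ← map_smul J, ← add_assoc, ← smul_add, ← map_add, ← h5] at key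
      convert! key using 2
      rw [hJ, opB_sectorL _ _ _ hκ1 hκ2, ← hJ, hf, map_sub, map_smul, map_smul, add_smul,
        add_sub_assoc]

/-- Eigenvalues given by power series with distinct first order coefficients separate. -/
theorem exists_ne_of_hasSum {a b : ℕ → ℝ} {f g : ℝ → ℝ} {c : ℝ} (hc : 0 < c)
    (hf : ∀ ε : ℝ, |ε| < c → HasSum (fun n => a n * ε ^ n) (f ε))
    (hg : ∀ ε : ℝ, |ε| < c → HasSum (fun n => b n * ε ^ n) (g ε))
    (h0 : a 0 = b 0) (h1 : a 1 ≠ b 1) : ∃ d > 0, ∀ ε : ℝ, |ε| < d → ε ≠ 0 → f ε ≠ g ε := by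
  have hs : ∀ ε : ℝ, |ε| < c → HasSum (fun n => ε ^ n • (a n - b n)) (f ε - g ε) :=
    fun ε hε => by
      refine ((hf ε hε).sub (hg ε hε)).congr_fun fun n => ?_
      rw [smul_eq_mul]; ring
  have hp := (hasFPowerSeriesOnBall_of_hasSum hc hs).hasFPowerSeriesAt
  have hd : HasDerivAt (fun ε => f ε - g ε) (a 1 - b 1) 0 := by
    simpa using hp.hasDerivAt
  have hz : f 0 - g 0 = 0 := by
    have h2 : HasSum (fun n => (0 : ℝ) ^ n • (a n - b n)) 0 := by
      convert! (hasSum_zero : HasSum (fun _ : ℕ => (0 : ℝ)) 0) using 2 with n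
      rcases n with _ | n <;> simp [h0]
    exact (hs 0 (by simpa using hc)).unique h2
  have he := hd.eventually_ne (c := 0) (sub_ne_zero.2 h1)
  rw [eventually_nhdsWithin_iff] at he
  obtain ⟨d, hd, h⟩ := Metric.eventually_nhds_iff.1 he
  exact ⟨d, hd, fun ε hε hne => sub_ne_zero.1 (h (by simpa using hε) hne)⟩

theorem mu_lt_mu {α γ₁ γ₂ : ℝ} (hγ : γ₂ < γ₁) {N : ℕ} (ho : overlap α N ≠ 0) :
    mu α γ₁ γ₂ N (-1) < mu α γ₁ γ₂ N 1 := by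
  have hb : 0 < beta₂ γ₁ γ₂ := by rw [beta₂]; linarith
  have : 0 < beta₂ γ₁ γ₂ * |overlap α N| / phiNormSq N :=
    div_pos (mul_pos hb (abs_pos.2 ho)) (phiNormSq_pos N)
  simp only [mu, Units.val_neg, Units.val_one, Int.cast_neg, Int.cast_one]
  linarith

/-- The conclusion is stated for every `c ≤ c₀`, so that one radius can later serve several `N`. -/
theorem exists_perturbed_eigenpairs {α γ₁ γ₂ : ℝ} (hγ : γ₂ < γ₁) {N : ℕ} (ho : overlap α N ≠ 0) :
    ∃ c₀ > 0, ∀ c > 0, c ≤ c₀ →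
      ∃ (lam : ℤˣ → ℝ → ℝ) (lamCoeff : ℤˣ → ℕ → ℝ)
        (u : ℤˣ → ℝ → L2C2) (uCoeff : ℤˣ → ℕ → 𝓢(ℝ, C2)),
        (∀ ε : ℝ, |ε| < c → ε ≠ 0 → lam (-1) ε ≠ lam 1 ε) ∧
        ∀ s : ℤˣ,
          AnalyticOnNhd ℝ (lam s) (Set.Ioo (-c) c) ∧
          (∀ ε : ℝ, |ε| < c → HasSum (fun n => lamCoeff s n * ε ^ n) (lam s ε)) ∧
          lamCoeff s 0 = N + 1 / 2 ∧
          lamCoeff s 1 = mu α γ₁ γ₂ N s ∧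
          AnalyticOnNhd ℝ (u s) (Set.Ioo (-c) c) ∧
          (∀ ε : ℝ, |ε| < c → HasSum (fun n => ε ^ n • (uCoeff s n).toLp 2) (u s ε)) ∧
          (∀ x : ℝ, uCoeff s 0 x = phiPM α N s x) ∧
          (∀ ε : ℝ, |ε| < c → ‖u s ε‖ = 1) ∧
          (∀ n : ℕ, 1 ≤ n →
            (inner ℂ ((uCoeff s 0).toLp 2 : L2C2) ((uCoeff s n).toLp 2)).im = 0) ∧
          (∀ ε : ℝ, |ε| < c → IsEigenEq (opAB α γ₁ γ₂ ε) (lam s ε : ℂ) (u s ε)) := by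
  choose c hc lam lamCoeff u uCoeff h0 h1 h2 h3 h4 using
    exists_perturbed_eigenpair α γ₁ γ₂ N ho
  have hcm : 0 < min (c (-1)) (c 1) := lt_min (hc _) (hc _)
  obtain ⟨d, hd, hne⟩ := exists_ne_of_hasSum hcm
    (fun ε hε => (h4 (-1) ε (hε.trans_le (min_le_left _ _))).1)
    (fun ε hε => (h4 1 ε (hε.trans_le (min_le_right _ _))).1)
    (by rw [h0, h0]) (by rw [h1, h1]; exact (mu_lt_mu hγ ho).ne)
  refine ⟨min (min (c (-1)) (c 1)) d, lt_min hcm hd, fun c' hc' hle =>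
    ⟨lam, lamCoeff, u, uCoeff, fun ε hε => hne ε (hε.trans_le (hle.trans (min_le_right _ _))),
      fun s => ?_⟩⟩
  have hs : c' ≤ c s := by
    refine (hle.trans (min_le_left _ _)).trans ?_
    rcases Int.units_eq_one_or s with rfl | rfl
    · exact min_le_right _ _
    · exact min_le_left _ _
  refine ⟨analyticOnNhd_of_hasSum (v := lamCoeff s) hc' fun ε hε => ?_,
    fun ε hε => (h4 s ε (hε.trans_le hs)).1, h0 s, h1 s,
    analyticOnNhd_of_hasSum hc' fun ε hε => (h4 s ε (hε.trans_le hs)).2.1,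
    fun ε hε => (h4 s ε (hε.trans_le hs)).2.1, h2 s,
    fun ε hε => (h4 s ε (hε.trans_le hs)).2.2.1, fun n _ => h3 s n,
    fun ε hε => (h4 s ε (hε.trans_le hs)).2.2.2⟩
  simpa [mul_comm] using (h4 s ε (hε.trans_le hs)).1

end Rabi

end

theorem theorem3p1 (α γ₁ γ₂ : ℝ) (hγ : γ₂ < γ₁)
    (hα : 2 * α ^ 2 ∈ Set.Ioi (0 : ℝ) \ Rabi.laguerreZeros) :
    (∃ (k : ℕ → ℕ) (δ : ℕ → ℝ), Rabi.IsRootGapSequence (2 * α ^ 2) k δ) ∧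
    ∀ (k : ℕ → ℕ) (δ : ℕ → ℝ), Rabi.IsRootGapSequence (2 * α ^ 2) k δ → ∀ j : ℕ,
      ∃ c ∈ Set.Ioo (0 : ℝ) 1, ∀ N ≤ k j,
        Module.finrank ℂ (Rabi.eigenspace Rabi.opA ((N : ℂ) + 1 / 2)) = 2 ∧
        Rabi.mu α γ₁ γ₂ N (-1) < Rabi.mu α γ₁ γ₂ N 1 ∧
        ∃ (lam : ℤˣ → ℝ → ℝ) (lamCoeff : ℤˣ → ℕ → ℝ)
          (u : ℤˣ → ℝ → Rabi.L2C2) (uCoeff : ℤˣ → ℕ → 𝓢(ℝ, Rabi.C2)),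
          (∀ ε : ℝ, |ε| < c → ε ≠ 0 → lam (-1) ε ≠ lam 1 ε) ∧
          ∀ s : ℤˣ,
            AnalyticOnNhd ℝ (lam s) (Set.Ioo (-c) c) ∧
            (∀ ε : ℝ, |ε| < c → HasSum (fun n => lamCoeff s n * ε ^ n) (lam s ε)) ∧
            lamCoeff s 0 = N + 1 / 2 ∧
            lamCoeff s 1 = Rabi.mu α γ₁ γ₂ N s ∧
            AnalyticOnNhd ℝ (u s) (Set.Ioo (-c) c) ∧
            (∀ ε : ℝ, |ε| < c → HasSum (fun n => ε ^ n • (uCoeff s n).toLp 2) (u s ε)) ∧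
            (∀ x : ℝ, uCoeff s 0 x = Rabi.phiPM α N s x) ∧
            (∀ ε : ℝ, |ε| < c → ‖u s ε‖ = 1) ∧
            (∀ n : ℕ, 1 ≤ n →
              (inner ℂ ((uCoeff s 0).toLp 2 : Rabi.L2C2) ((uCoeff s n).toLp 2)).im = 0) ∧
            (∀ ε : ℝ, |ε| < c →
              Rabi.IsEigenEq (Rabi.opAB α γ₁ γ₂ ε) (lam s ε : ℂ) (u s ε)) := by
  have hL : ∀ n, (Rabi.laguerre n).eval (2 * α ^ 2) ≠ 0 := fun n h =>
    hα.2 ⟨by positivity, n, h⟩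
  have ho : ∀ N, Rabi.overlap α N ≠ 0 := fun N => Rabi.overlap_ne_zero (hL N)
  refine ⟨Rabi.exists_isRootGapSequence hL, fun k δ _ j => ?_⟩
  choose c₀ hc₀ h using fun N => Rabi.exists_perturbed_eigenpairs hγ (ho N)
  have hne : (Finset.range (k j + 1)).Nonempty := ⟨0, by simp⟩
  -- The bound `1/2` only ensures `c < 1`; the infimum runs over the finitely many `N ≤ k j`.
  have hpos : 0 < min ((Finset.range (k j + 1)).inf' hne c₀) (1 / 2) :=
    lt_min ((Finset.lt_inf'_iff _).2 fun N _ => hc₀ N) (by norm_num)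
  refine ⟨min ((Finset.range (k j + 1)).inf' hne c₀) (1 / 2),
    ⟨hpos, (min_le_right _ _).trans_lt (by norm_num)⟩, fun N hN =>
    ⟨Rabi.finrank_eigenspace_opA N, Rabi.mu_lt_mu hγ (ho N), h N _ hpos ?_⟩⟩
  exact (min_le_left _ _).trans (Finset.inf'_le _ (Finset.mem_range.2 (Nat.lt_succ_of_le hN)))
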